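/- Let $\Delta=\{(s,t): 0\le s\le t<\infty\}$, and let $[0,\infty]$ carry its usual compact topology and Borel $\sigma$-field $\mathcal B([0,\infty])$. Let $(k_{s,t})_{(s,t)\in\Delta}$ be a family of transition (Markov) kernels on $[0,\infty]$ such that (K1) $k_{s,s}(x,\cdot)=\delta_x$ for all $s\ge 0$, $x\in[0,\infty]$; (K2) $\int_{[0,\infty]} k_{t,u}(y,B)\,k_{s,t}(x,\mathrm dy)=k_{s,u}(x,B)$ for all $0\le s\le t\le u$, $x\in[0,\infty]$, $B\in\mathcal B([0,\infty])$; (K3) $\Delta\times[0,\infty)\ni(s,t,x)\mapsto k_{s,t}(x,\cdot)$ is continuous for the weak topology on the Borel probability measures on $[0,\infty]$; (K4) $k_{s,t}(x,\cdot)*k_{s,t}(y,\cdot)=k_{s,t}(x+y,\cdot)$ for all $(s,t)\in\Delta$ and $x,y\in[0,\infty)$, where $*$ is the convolution of probability measures on $([0,\infty],+)$; (K5) $k_{s,t}(0,\cdot)=\delta_0$ for all $(s,t)\in\Delta$; (K6) $k_{s,t}(\infty,\cdot)=\delta_\infty$ for all $(s,t)\in\Delta$. Let $D[0,\infty)$ be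 the set of all càdlàg functions $\omega\colon[0,\infty)\to[0,\infty]$ such that, if $r:=\omega(t)\in\{0,\infty\}$ for some $t\ge0$ or $r:=\omega(t-)\in\{0,\infty\}$ for some $t>0$, then $\omega(u)=r$ for all $u\ge t$. Let $X_t(\omega):=\omega(t)$ be the coordinate process on $D[0,\infty)$, and $\mathcal G_I:=\sigma(X_t: t\in I)$ for closed intervals $I\subset[0,\infty)$. Then there exists a unique map $(s,x)\mapsto\mathbb Q^{(s,x)}$ assigning to each $s\ge0$ and $x\in[0,\infty]$ a probability measure $\mathbb Q^{(s,x)}$ on $(D[0,\infty),\mathcal G_{[s,\infty)})$ such that $(X_t)_{t\ge0}$, with the $\sigma$-fields $(\mathcal G_I)_I$ and the measures $(\mathbb Q^{(s,x)})$, is a branching process with transition kernels $(k_{s,t})$, that is: - $\mathbb Q^{(s,x)}[X_s=x]=1$ for all $s\ge0$, $x\in[0,\infty]$; - $\mathbb E_{\mathbb Q^{(s,x)}}\big[f(X_u)\,\big|\,\mathcal G_{[s,t]}\big]=\int_{[0,\infty]}f(y)\,k_{t,u}(X_t,\mathrm dy)$ $\mathbb Q^{(s,x)}$-almost surely, for all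 $0\le s\le t\le u$, $x\in[0,\infty]$ and all bounded Borel measurable $f\colon[0,\infty]\to\mathbb R$. -/

import Mathlib

open MeasureTheory ProbabilityTheory Filter Set
open scoped NNReal ENNReal Topology ProbabilityTheory

/-- A family of transition kernels `k s t` (`0 ≤ s ≤ t`) on `S` with `k s s x = δ_x` and the
Chapman-Kolmogorov equation. Values `k s t` with `t < s` are irrelevant. -/
structure IsTransitionFamily {S : Type*} [MeasurableSpace S]
    (k : ℝ≥0 → ℝ≥0 → Kernel S S) : Prop where
  markov : ∀ s t, s ≤ t → IsMarkovKernel (k s t)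
  diag : ∀ s x, k s s x = Measure.dirac x
  /-- `∫ k t u y B (k s t x) (dy) = k s u x B` -/
  chapman_kolmogorov : ∀ s t u, s ≤ t → t ≤ u → (k t u) ∘ₖ (k s t) = k s u

/-- The probability measure `k s t x`, for `s ≤ t`. -/
def IsTransitionFamily.law {S : Type*} [MeasurableSpace S] {k : ℝ≥0 → ℝ≥0 → Kernel S S}
    (h : IsTransitionFamily k) (s t : ℝ≥0) (hst : s ≤ t) (x : S) : ProbabilityMeasure S :=
  ⟨k s t x, (h.markov s t hst).isProbabilityMeasure x⟩

/-- A family of transition kernels of a branching process on `[0,∞]`. -/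
structure IsBranchingKernelFamily (k : ℝ≥0 → ℝ≥0 → Kernel ℝ≥0∞ ℝ≥0∞) : Prop
    extends IsTransitionFamily k where
  /-- Weak continuity of `(s,t,x) ↦ k s t x` on `{s ≤ t} × [0,∞)`. -/
  weak_continuous :
    Continuous (fun p : {q : ℝ≥0 × ℝ≥0 // q.1 ≤ q.2} × ℝ≥0 =>
      toIsTransitionFamily.law p.1.1.1 p.1.1.2 p.1.2 (p.2 : ℝ≥0∞))
  /-- The branching property, with the convolution of measures on `([0,∞], +)`. -/
  branching : ∀ s t, s ≤ t → ∀ x y : ℝ≥0,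
    Measure.conv (k s t (x : ℝ≥0∞)) (k s t (y : ℝ≥0∞)) = k s t ((x + y : ℝ≥0) : ℝ≥0∞)
  zero : ∀ s t, s ≤ t → k s t 0 = Measure.dirac 0
  top : ∀ s t, s ≤ t → k s t ∞ = Measure.dirac ∞

/-- Closed intervals of `[0,∞)`, bounded or not. -/
def IsClosedInterval (I : Set ℝ≥0) : Prop :=
  (∃ a b, a ≤ b ∧ I = Icc a b) ∨ ∃ a, I = Ici a

/-- A Markov family `(Z, Ω, ℱ, (ℱ_I), (P^{(s,x)}))` on `S` with transition kernels `k`; the measure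
`P s x` lives on the σ-field `ℱ_{[s,∞)}`. Only the σ-fields indexed by closed intervals matter. -/
structure IsMarkovFamily {S Ω : Type*} [MeasurableSpace S] (k : ℝ≥0 → ℝ≥0 → Kernel S S)
    (Z : ℝ≥0 → Ω → S) (F : MeasurableSpace Ω) (FI : Set ℝ≥0 → MeasurableSpace Ω)
    (P : (s : ℝ≥0) → S → @Measure Ω (FI (Ici s))) : Prop where
  transition : IsTransitionFamily k
  sub : ∀ I, IsClosedInterval I → FI I ≤ F
  mono : ∀ I J, IsClosedInterval I → IsClosedInterval J → I ⊆ J → FI I ≤ FI J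
  adapted : ∀ I, IsClosedInterval I → ∀ t ∈ I, Measurable[FI I] (Z t)
  prob : ∀ s x, @IsProbabilityMeasure Ω (FI (Ici s)) (P s x)
  initial : ∀ s x, P s x {ω | Z s ω = x} = 1
  markov_property : ∀ s t u, s ≤ t → t ≤ u → ∀ x, ∀ f : S → ℝ, Measurable f →
    (∃ C : ℝ, ∀ y, |f y| ≤ C) →
      (P s x)[fun ω => f (Z u ω) | FI (Icc s t)] =ᵐ[P s x] fun ω => ∫ y, f y ∂(k t u (Z t ω))

/-- A (time-inhomogeneous, continuous-state) branching process with transition kernels `k`. -/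
structure IsBranchingProcess {Ω : Type*} (k : ℝ≥0 → ℝ≥0 → Kernel ℝ≥0∞ ℝ≥0∞)
    (Z : ℝ≥0 → Ω → ℝ≥0∞) (F : MeasurableSpace Ω) (FI : Set ℝ≥0 → MeasurableSpace Ω)
    (P : (s : ℝ≥0) → ℝ≥0∞ → @Measure Ω (FI (Ici s))) : Prop where
  kernels : IsBranchingKernelFamily k
  markov_family : IsMarkovFamily k Z F FI P

/-- `ω` is right-continuous and has left limits in `[0,∞]`
(for `t = 0` the left-limit condition is void, as `𝓝[<] 0 = ⊥`). -/
def IsCadlagPath (ω : ℝ≥0 → ℝ≥0∞) : Prop :=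
  ∀ t, ContinuousWithinAt ω (Ici t) t ∧ ∃ l, Tendsto ω (𝓝[<] t) (𝓝 l)

/-- Once `ω` or its left limit hits `r ∈ {0,∞}` at time `t`, `ω` equals `r` from time `t` on. -/
def IsAbsorbedPath (ω : ℝ≥0 → ℝ≥0∞) : Prop :=
  ∀ r : ℝ≥0∞, r = 0 ∨ r = ∞ → ∀ t : ℝ≥0,
    (ω t = r ∨ (0 < t ∧ Tendsto ω (𝓝[<] t) (𝓝 r))) → ∀ u, t ≤ u → ω u = r

/-- The path space `D[0,∞)`. -/
def BranchingPathSpace : Type :=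
  {ω : ℝ≥0 → ℝ≥0∞ // IsCadlagPath ω ∧ IsAbsorbedPath ω}

/-- The coordinate process on `D[0,∞)`. -/
def coordProcess (t : ℝ≥0) (ω : BranchingPathSpace) : ℝ≥0∞ := ω.1 t

/-- The natural σ-field `𝒢_I = σ(X_t : t ∈ I)` on `D[0,∞)`. -/
abbrev coordSigma (I : Set ℝ≥0) : MeasurableSpace BranchingPathSpace :=
  ⨆ t ∈ I, MeasurableSpace.comap (coordProcess t) inferInstance

/-! Write L_{s,t}(y) = ∫ exp(-z) k_{s,t}(y,dz). The branching property makes L_{s,t} multiplicative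
in y on [0,∞), and weak continuity forces 0 < L_{s,t}(1) < 1 (`laplaceKernel_ne_zero`,
`laplaceKernel_one_lt_one`). Hence L_{s,t} is strictly decreasing on [0,∞], and it is jointly
continuous in the starting time and the starting point, even at ∞ (`continuous_laplaceKernel_left`).

Let X be a Markov process along the rational times, obtained by Kolmogorov extension
(`exists_measure_isMarkovOn`). By Chapman-Kolmogorov, q ↦ L_{q,T}(X_q) is a martingale with values
in [0,1] up to the horizon T. Dubins' inequality bounds its upcrossings, so it has one-sided limits
along the rationals, and inverting L transfers these limits to X. Absorption comes from the same
inequality: a nonnegative supermartingale that gets arbitrarily close to 0 stays near 0. It is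
applied to the martingale itself (small when X is near ∞) and to one minus it (small when X is near
0); see `ae_isRegularPath`.

The right limits of X therefore form a process with paths in D[0,∞). Its Markov property follows by
approximating real times by larger rational ones and using weak continuity of the kernels
(`isMarkovOn_rightPath`). Weak continuity is not assumed at the starting point ∞; there absorption
replaces it. A start at time s is reduced to a start at time 0 by freezing the kernels before s.

For uniqueness, the initial value and the Markov property determine all finite-dimensional
distributions, and these determine a measure on the σ-field generated by the coordinates
(`pathLaw_unique`). Throughout, the Markov property is tested on finite products, a form that passes
to marginals, images and limits; it is translated to and from conditional expectations only at the
end. -/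

/-! ### Markov property in terms of finite products -/

/-- Transition kernels indexed by an arbitrary preorder of times. -/
structure IsTransitionOn {T S : Type*} [Preorder T] [MeasurableSpace S]
    (κ : T → T → Kernel S S) : Prop where
  markov : ∀ s t, s ≤ t → IsMarkovKernel (κ s t)
  diag : ∀ s x, κ s s x = Measure.dirac x
  comp : ∀ s t u, s ≤ t → t ≤ u → (κ t u) ∘ₖ (κ s t) = κ s u

/-- The Markov property of a process `Y` along the set of times `J`, tested on finite products. -/
def IsMarkovOn {T S Ω : Type*} [LinearOrder T] [MeasurableSpace S] (κ : T → T → Kernel S S)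
    (J : Set T) (Y : T → Ω → S) {mΩ : MeasurableSpace Ω} (μ : Measure Ω) : Prop :=
  ∀ a ∈ J, ∀ b ∈ J, a ≤ b → ∀ K : Finset T, (∀ t ∈ K, t ∈ J ∧ t ≤ a) →
    ∀ g : T → S → ℝ≥0∞, (∀ t, Measurable (g t)) → ∀ f : S → ℝ≥0∞, Measurable f →
      ∫⁻ ω, (∏ t ∈ K, g t (Y t ω)) * f (Y b ω) ∂μ =
        ∫⁻ ω, (∏ t ∈ K, g t (Y t ω)) * ∫⁻ y, f y ∂(κ a b (Y a ω)) ∂μ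

section MarkovOn

variable {T S Ω Ω' : Type*} [LinearOrder T] [MeasurableSpace S] {κ : T → T → Kernel S S}
  {J : Set T} {Y : T → Ω → S} {Y' : T → Ω' → S} {mΩ : MeasurableSpace Ω} {mΩ' : MeasurableSpace Ω'}
  {μ : Measure Ω} {μ' : Measure Ω'}

lemma IsMarkovOn.mono {J' : Set T} (h : IsMarkovOn κ J Y μ) (hJ : J' ⊆ J) :
    IsMarkovOn κ J' Y μ :=
  fun a ha b hb hab K hK g hg f hf =>
    h a (hJ ha) b (hJ hb) hab K (fun t ht => ⟨hJ (hK t ht).1, (hK t ht).2⟩) g hg f hf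

-- After the latest time has been integrated out, the resulting kernel factor sits at the time `a`
-- before it. Merging it into `g a` restores the product form needed for induction on the times.
omit [MeasurableSpace S] in
lemma prod_mul_apply_eq_prod_update {K : Finset T} {a : T} (ha : a ∈ K) (g : T → S → ℝ≥0∞)
    (φ : S → ℝ≥0∞) (y : T → S) :
    (∏ t ∈ K, g t (y t)) * φ (y a) =
      ∏ t ∈ K, Function.update g a (fun z => g a z * φ z) t (y t) := by
  rw [← Finset.mul_prod_erase K _ ha, ← Finset.mul_prod_erase K _ ha, Function.update_self,
    mul_right_comm]
  congr 1
  refine Finset.prod_congr rfl fun t ht => ?_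
  rw [Function.update_of_ne (Finset.ne_of_mem_erase ht)]

lemma measurable_update_fun {g : T → S → ℝ≥0∞} (hg : ∀ t, Measurable (g t)) (a : T)
    {φ : S → ℝ≥0∞} (hφ : Measurable φ) (t : T) : Measurable (Function.update g a φ t) := by
  rcases eq_or_ne t a with rfl | h
  · simpa using hφ
  · simpa [Function.update_of_ne h] using hg t

lemma IsMarkovOn.lintegral_eq_of_initial [IsProbabilityMeasure μ] (h : IsMarkovOn κ J Y μ)
    {c b : T} (hc : c ∈ J) (hb : b ∈ J) (hcb : c ≤ b) {x : S} (h0 : ∀ᵐ ω ∂μ, Y c ω = x)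
    {f : S → ℝ≥0∞} (hf : Measurable f) :
    ∫⁻ ω, f (Y b ω) ∂μ = ∫⁻ y, f y ∂(κ c b x) := by
  have := h c hc b hb hcb ∅ (by simp) (fun _ => 1) (fun _ => measurable_const) f hf
  simp only [Finset.prod_empty, one_mul] at this
  rw [this, lintegral_congr_ae (g := fun _ => ∫⁻ y, f y ∂(κ c b x))]
  · simp
  · filter_upwards [h0] with ω hω
    rw [hω]

/-- Finite-dimensional distributions are determined by the Markov property and the initial value. -/
lemma IsMarkovOn.lintegral_prod_eq [IsProbabilityMeasure μ] [IsProbabilityMeasure μ']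
    (h : IsMarkovOn κ J Y μ) (h' : IsMarkovOn κ J Y' μ') {c : T} (hc : c ∈ J) {x : S}
    (h0 : ∀ᵐ ω ∂μ, Y c ω = x) (h0' : ∀ᵐ ω ∂μ', Y' c ω = x) (K : Finset T) :
    (∀ t ∈ K, t ∈ J ∧ c ≤ t) → ∀ g : T → S → ℝ≥0∞, (∀ t, Measurable (g t)) →
      ∫⁻ ω, ∏ t ∈ K, g t (Y t ω) ∂μ = ∫⁻ ω, ∏ t ∈ K, g t (Y' t ω) ∂μ' := by
  induction K using Finset.induction_on_max with
  | empty => simp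
  | insert b K hlt ih =>
    intro hK g hg
    have hbK : b ∉ K := fun hb => lt_irrefl b (hlt b hb)
    have hbJ := hK b (Finset.mem_insert_self _ _)
    have hKJ : ∀ t ∈ K, t ∈ J ∧ c ≤ t := fun t ht => hK t (Finset.mem_insert_of_mem ht)
    simp_rw [Finset.prod_insert hbK, mul_comm (g b _)]
    rcases K.eq_empty_or_nonempty with rfl | hne
    · simp only [Finset.prod_empty, one_mul]
      rw [h.lintegral_eq_of_initial hc hbJ.1 hbJ.2 h0 (hg b),
        h'.lintegral_eq_of_initial hc hbJ.1 hbJ.2 h0' (hg b)]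
    · have ha := K.max'_mem hne
      set a := K.max' hne with ha'
      have hle : ∀ t ∈ K, t ∈ J ∧ t ≤ a := fun t ht => ⟨(hKJ t ht).1, K.le_max' t ht⟩
      rw [h a (hKJ a ha).1 b hbJ.1 (hlt a ha).le K hle g hg (g b) (hg b),
        h' a (hKJ a ha).1 b hbJ.1 (hlt a ha).le K hle g hg (g b) (hg b)]
      have e := fun y : T → S =>
        prod_mul_apply_eq_prod_update ha g (fun z => ∫⁻ y, g b y ∂(κ a b z)) y
      simp_rw [fun ω => e (fun t => Y t ω), fun ω => e (fun t => Y' t ω)]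
      exact ih hKJ _ (measurable_update_fun hg a ((hg a).mul (hg b).lintegral_kernel))

/-- Finite-dimensional laws are determined by integrals of products. -/
lemma map_restrict_eq_of_lintegral_prod_eq [IsFiniteMeasure μ]
    {K : Finset T} (hY : ∀ t ∈ K, Measurable (Y t)) (hY' : ∀ t ∈ K, Measurable (Y' t))
    (h : ∀ g : T → S → ℝ≥0∞, (∀ t, Measurable (g t)) →
      ∫⁻ ω, ∏ t ∈ K, g t (Y t ω) ∂μ = ∫⁻ ω, ∏ t ∈ K, g t (Y' t ω) ∂μ') :
    μ.map (fun ω (t : K) => Y t ω) = μ'.map (fun ω (t : K) => Y' t ω) := by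
  have mY : Measurable (fun ω (t : K) => Y t ω) := measurable_pi_iff.2 fun t => hY t t.2
  have mY' : Measurable (fun ω (t : K) => Y' t ω) := measurable_pi_iff.2 fun t => hY' t t.2
  classical
  refine ext_of_generate_finite _ generateFrom_pi.symm isPiSystem_pi ?_ ?_
  · rintro _ ⟨B, hB, rfl⟩
    have hB' : ∀ t, MeasurableSet (B t) := fun t => hB t (mem_univ t)
    have hms : MeasurableSet (univ.pi B) := MeasurableSet.univ_pi hB'
    rw [Measure.map_apply mY hms, Measure.map_apply mY' hms]
    rw [← lintegral_indicator_one (mY hms), ← lintegral_indicator_one (mY' hms)]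
    let g : T → S → ℝ≥0∞ := fun t => if ht : t ∈ K then (B ⟨t, ht⟩).indicator 1 else 1
    have hg : ∀ t, Measurable (g t) := by
      intro t
      by_cases ht : t ∈ K
      · simpa [g, ht] using measurable_one.indicator (hB' _)
      · simpa [g, ht] using (measurable_one : Measurable (1 : S → ℝ≥0∞))
    have e : ∀ y : T → S, ∏ t ∈ K, g t (y t) = if ∀ t : K, y t ∈ B t then 1 else 0 := by
      intro y
      rw [← Finset.prod_coe_sort]
      have : ∀ t : K, g t (y t) = if y t ∈ B t then 1 else 0 := by
        intro t
        simp [g, Set.indicator_apply]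
      simp_rw [this, Finset.prod_ite_zero]
      simp
    have := h g hg
    simp_rw [fun ω => e (fun t => Y t ω), fun ω => e (fun t => Y' t ω)] at this
    convert this using 2
    · ext ω; simp [Set.indicator_apply]
    · ext ω; simp [Set.indicator_apply]
  · rw [Measure.map_apply mY .univ, Measure.map_apply mY' .univ]
    simpa using h (fun _ _ => 1) (fun _ => measurable_const)

end MarkovOn

/-- The product form of the Markov property extends to all nonnegative functions measurable with
respect to the past. -/
lemma IsMarkovOn.lintegral_mul {T S Ω : Type*} [LinearOrder T] [MeasurableSpace S]
    {κ : T → T → Kernel S S} {J : Set T} {Y : T → Ω → S} {m mΩ : MeasurableSpace Ω}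
    {μ : Measure Ω} [IsFiniteMeasure μ] (h : IsMarkovOn κ J Y μ)
    (hκ : IsTransitionOn κ) (hY : ∀ t ∈ J, Measurable (Y t)) {a b : T} (ha : a ∈ J) (hb : b ∈ J)
    (hab : a ≤ b) (hm : m = ⨆ t ∈ J ∩ Iic a, MeasurableSpace.comap (Y t) inferInstance)
    {G : Ω → ℝ≥0∞} (hG : Measurable[m] G)
    {f : S → ℝ≥0∞} (hf : Measurable f) {C : ℝ≥0} (hfC : ∀ y, f y ≤ C) :
    ∫⁻ ω, G ω * f (Y b ω) ∂μ = ∫⁻ ω, G ω * ∫⁻ y, f y ∂(κ a b (Y a ω)) ∂μ := by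
  have := hκ.markov a b hab
  have hmle : m ≤ mΩ := hm.trans_le <| iSup₂_le fun t ht => (hY t ht.1).comap_le
  have hkf : Measurable fun z => ∫⁻ y, f y ∂(κ a b z) := hf.lintegral_kernel
  have hkC : ∀ z, ∫⁻ y, f y ∂(κ a b z) ≤ C := fun z =>
    (lintegral_mono hfC).trans (by simp)
  have fin : ∀ φ : Ω → ℝ≥0∞, (∀ ω, φ ω ≤ C) → IsFiniteMeasure (μ.withDensity φ) := fun φ hφ =>
    isFiniteMeasure_withDensity
      (((lintegral_mono hφ).trans_lt (by simp [ENNReal.mul_lt_top_iff])).ne)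
  have fin1 := fin (fun ω => f (Y b ω)) fun ω => hfC _
  have fin2 := fin (fun ω => ∫⁻ y, f y ∂(κ a b (Y a ω))) fun ω => hkC _
  have m1 : Measurable fun ω => f (Y b ω) := hf.comp (hY b hb)
  have m2 : Measurable fun ω => ∫⁻ y, f y ∂(κ a b (Y a ω)) := hkf.comp (hY a ha)
  -- Both sides of the goal integrate `G` against a finite measure with density. These measures need
  -- only agree on `m`, hence only on the π-system of cylinders, where the product form applies.
  have key : (μ.withDensity fun ω => f (Y b ω)).trim hmle =
      (μ.withDensity fun ω => ∫⁻ y, f y ∂(κ a b (Y a ω))).trim hmle := by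
    have cyl : ∀ s ∈ piiUnionInter (fun t => {s | MeasurableSet[MeasurableSpace.comap (Y t)
        inferInstance] s}) (J ∩ Iic a),
        (μ.withDensity fun ω => f (Y b ω)) s =
          (μ.withDensity fun ω => ∫⁻ y, f y ∂(κ a b (Y a ω))) s := by
      rintro s ⟨K, hK, A, hA, rfl⟩
      choose! B hB hBA using hA
      classical
      have hms : MeasurableSet (⋂ t ∈ K, A t) := Finset.measurableSet_biInter _ fun t ht => by
        rw [← hBA t ht]; exact hY t (hK ht).1 (hB t ht)
      rw [withDensity_apply _ hms, withDensity_apply _ hms, ← lintegral_indicator hms,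
        ← lintegral_indicator hms]
      let g : T → S → ℝ≥0∞ := fun t => if t ∈ K then (B t).indicator 1 else 1
      have hg : ∀ t, Measurable (g t) := by
        intro t
        by_cases ht : t ∈ K
        · simpa [g, ht] using measurable_one.indicator (hB t ht)
        · simpa [g, ht] using (measurable_one : Measurable (1 : S → ℝ≥0∞))
      have e : ∀ ω, ∏ t ∈ K, g t (Y t ω) = if ω ∈ ⋂ t ∈ K, A t then 1 else 0 := by
        intro ω
        have : ∀ t ∈ K, g t (Y t ω) = if ω ∈ A t then 1 else 0 := by
          intro t ht
          simp [g, ht, Set.indicator_apply, ← hBA t ht]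
        rw [Finset.prod_congr rfl this, Finset.prod_ite_zero]
        simp
      have := h a ha b hb hab K (fun t ht => ⟨(hK ht).1, (hK ht).2⟩) g hg f hf
      simp_rw [e, ite_mul, one_mul, zero_mul] at this
      exact this
    refine ext_of_generate_finite _
      (hm.trans (generateFrom_piiUnionInter_measurableSet _ (J ∩ Iic a)).symm)
      (isPiSystem_piiUnionInter _ (fun t =>
        @MeasurableSpace.isPiSystem_measurableSet _ (MeasurableSpace.comap (Y t) inferInstance))
        _) ?_ ?_
    · intro s hs
      have hs' : MeasurableSet[m] s :=
        hm ▸ measurableSet_iSup_of_mem_piiUnionInter _ _ _ hs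
      rw [trim_measurableSet_eq hmle hs', trim_measurableSet_eq hmle hs', cyl s hs]
    · rw [trim_measurableSet_eq hmle .univ, trim_measurableSet_eq hmle .univ]
      exact cyl _ ⟨∅, by simp, fun _ => univ, by simp, by simp⟩
  have hG' : Measurable G := hG.mono hmle le_rfl
  have := congrArg (fun ν : @Measure Ω m => @lintegral Ω m ν G) key
  simp only [lintegral_trim hmle hG] at this
  rw [lintegral_withDensity_eq_lintegral_mul _ m1 hG',
    lintegral_withDensity_eq_lintegral_mul _ m2 hG'] at this
  simpa only [Pi.mul_apply, mul_comm] using this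

/-! ### Kolmogorov extension for transition kernels along a countable set of times -/

section Chain

variable {T S : Type*} [LinearOrder T] [MeasurableSpace S] {κ : T → T → Kernel S S}

omit [LinearOrder T] in
lemma measurableSet_apply_eq [MeasurableSingletonClass S] (t : T) (x : S) :
    MeasurableSet {ω : T → S | ω t = x} :=
  (measurable_pi_apply t : Measurable fun ω : T → S => ω t) (measurableSet_singleton x)

/-- Overwrite the value at time `b` by a sample of `κ a b` started in the value at time `a`. -/
noncomputable def stepKernel (κ : T → T → Kernel S S) (a b : T) : Kernel (T → S) (T → S) :=
  (Kernel.id ×ₖ (κ a b).comap (fun ω : T → S => ω a) (measurable_pi_apply a)).map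
    (fun p => Function.update p.1 b p.2)

lemma measurable_update_prod (b : T) :
    Measurable (fun p : (T → S) × S => Function.update p.1 b p.2) := by
  refine measurable_pi_iff.2 fun t => ?_
  rcases eq_or_ne t b with rfl | h
  · simpa using measurable_snd
  · simpa [Function.update_of_ne h] using! (measurable_pi_apply t).comp measurable_fst

instance (a b : T) [IsMarkovKernel (κ a b)] : IsMarkovKernel (stepKernel κ a b) :=
  Kernel.IsMarkovKernel.map _ (measurable_update_prod b)

lemma lintegral_stepKernel (a b : T) [IsMarkovKernel (κ a b)] (ω : T → S) {F : (T → S) → ℝ≥0∞}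
    (hF : Measurable F) :
    ∫⁻ ω', F ω' ∂(stepKernel κ a b ω) = ∫⁻ y, F (Function.update ω b y) ∂(κ a b (ω a)) := by
  rw [stepKernel, Kernel.lintegral_map _ (measurable_update_prod b) _ hF,
    Kernel.lintegral_id_prod (f := fun p : (T → S) × S => F (Function.update p.1 b p.2))
      (hF.comp (measurable_update_prod b))]
  rfl

variable [OrderBot T]

/-- The law of the Markov chain started in `x` and sampled at the times in the (decreasing) list
`l`, as a measure on functions on the whole time set. -/
noncomputable def chainLaw (κ : T → T → Kernel S S) (x : S) : List T → Measure (T → S)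
  | [] => Measure.dirac fun _ => x
  | b :: l => (chainLaw κ x l).bind (stepKernel κ (l.headD ⊥) b)

lemma lintegral_chainLaw_cons (x : S) (b : T) (l : List T) [IsMarkovKernel (κ (l.headD ⊥) b)]
    {F : (T → S) → ℝ≥0∞} (hF : Measurable F) :
    ∫⁻ ω, F ω ∂(chainLaw κ x (b :: l)) =
      ∫⁻ ω, ∫⁻ y, F (Function.update ω b y) ∂(κ (l.headD ⊥) b (ω (l.headD ⊥)))
        ∂(chainLaw κ x l) := by
  rw [chainLaw, Measure.lintegral_bind (Kernel.aemeasurable _) hF.aemeasurable]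
  exact lintegral_congr fun ω => lintegral_stepKernel _ _ _ hF

lemma headD_mem_insert (l : List T) : l.headD ⊥ ∈ insert ⊥ {t | t ∈ l} := by
  cases l <;> simp

lemma le_headD {l : List T} (hl : l.Pairwise (· > ·)) {a : T} (ha : a ∈ insert ⊥ {t | t ∈ l}) :
    a ≤ l.headD ⊥ := by
  rcases ha with rfl | ha
  · exact bot_le
  · cases l with
    | nil => simp at ha
    | cons c l =>
      rcases List.mem_cons.1 ha with rfl | h
      · exact le_rfl
      · exact ((List.pairwise_cons.1 hl).1 a h).le

lemma headD_lt {b : T} {l : List T} (hl : (b :: l).Pairwise (· > ·)) (h0 : ⊥ < b) :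
    l.headD ⊥ < b := by
  rcases headD_mem_insert l with h | h
  · rwa [h]
  · exact (List.pairwise_cons.1 hl).1 _ h

/-- Each new time exceeds all earlier ones, so the step kernel leaves the past untouched and depends
on it only through the head of the list, its latest time. -/
lemma chainLaw_isMarkovOn [MeasurableSingletonClass S] (hκ : IsTransitionOn κ) (x : S) (l : List T) :
    l.Pairwise (· > ·) → (∀ t ∈ l, ⊥ < t) →
      IsProbabilityMeasure (chainLaw κ x l) ∧ (∀ᵐ ω ∂(chainLaw κ x l), ω ⊥ = x) ∧
      IsMarkovOn κ (insert ⊥ {t | t ∈ l}) (fun t ω => ω t) (chainLaw κ x l) := by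
  induction l with
  | nil =>
    refine fun _ _ => ⟨by rw [chainLaw]; infer_instance, ?_, ?_⟩
    · have hms : MeasurableSet {ω : T → S | ω ⊥ = x} :=
        measurableSet_apply_eq ⊥ x
      rw [chainLaw, ae_dirac_iff hms]
    · rintro a (rfl | ha) b (rfl | hb) - K - g hg f hf
      · simp only [hκ.diag, lintegral_dirac' _ hf]
      all_goals simp_all
  | cons b l ih =>
    intro hl h0
    have hl' := List.pairwise_cons.1 hl
    have hb0 := h0 b (by simp)
    obtain ⟨hp, hi, hM⟩ := ih hl'.2 fun t ht => h0 t (List.mem_cons_of_mem _ ht)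
    have hcb := headD_lt hl hb0
    have hcm := headD_mem_insert l
    have hmax := fun {a} => le_headD hl'.2 (a := a)
    have hlt : ∀ t ∈ insert ⊥ {t | t ∈ l}, t < b := fun t ht => (hmax ht).trans_lt hcb
    have := hκ.markov _ b hcb.le
    have formula := fun {F} => lintegral_chainLaw_cons (κ := κ) x b l (F := F)
    set c := l.headD ⊥ with hc
    have prob : IsProbabilityMeasure (chainLaw κ x (b :: l)) := ⟨by
      have := formula (F := fun _ => 1) measurable_const
      simpa using this⟩
    refine ⟨prob, ?_, ?_⟩
    · have hms : MeasurableSet {ω : T → S | ω ⊥ = x}ᶜ :=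
        (measurableSet_apply_eq ⊥ x).compl
      have := formula (measurable_one.indicator hms)
      rw [lintegral_indicator_one hms] at this
      refine this.trans ?_
      rw [lintegral_congr_ae (g := 0)]
      · simp
      · filter_upwards [hi] with ω hω
        simp [Function.update_of_ne hb0.ne, hω]
    · have eins : (insert ⊥ {t | t ∈ b :: l} : Set T) = insert b (insert ⊥ {t | t ∈ l}) := by
        ext t; simp; tauto
      rw [eins]
      intro a ha b' hb' hab K hK g hg f hf
      have hupd : ∀ (a' : T) (ω : T → S) (y : S), a' < b → (∀ t ∈ K, t ≤ a') →
          ∏ t ∈ K, g t (Function.update ω b y t) = ∏ t ∈ K, g t (ω t) := fun a' ω y ha' hK' =>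
        Finset.prod_congr rfl fun t ht => by
          rw [Function.update_of_ne ((hK' t ht).trans_lt ha').ne]
      have hKm : Measurable fun ω : T → S => ∏ t ∈ K, g t (ω t) :=
        Finset.measurable_fun_prod _ fun t _ => (hg t).comp (measurable_pi_apply t)
      have hkf : ∀ a b, Measurable fun z => ∫⁻ y, f y ∂(κ a b z) := fun a b => hf.lintegral_kernel
      have hK' : a ∈ insert ⊥ {t | t ∈ l} → ∀ t ∈ K, t ∈ insert ⊥ {t | t ∈ l} ∧ t ≤ a := by
        intro ha t ht
        refine ⟨((hK t ht).1).resolve_left ?_, (hK t ht).2⟩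
        exact ((hK t ht).2.trans_lt (hlt a ha)).ne
      have m1 : Measurable fun ω : T → S => (∏ t ∈ K, g t (ω t)) * f (ω b') :=
        hKm.mul (hf.comp (measurable_pi_apply b'))
      have m2 : Measurable fun ω : T → S => (∏ t ∈ K, g t (ω t)) * ∫⁻ y, f y ∂(κ a b' (ω a)) :=
        hKm.mul ((hkf a b').comp (measurable_pi_apply a))
      rw [formula m1, formula m2]
      rcases ha with rfl | ha
      · obtain rfl : a = b' := by
          rcases hb' with rfl | hb'
          · rfl
          · exact absurd (hlt b' hb') (not_lt.2 hab)
        simp_rw [hκ.diag, lintegral_dirac' _ hf]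
      · have hab' := hlt a ha
        simp_rw [fun ω y => hupd a ω y hab' (fun t ht => (hK t ht).2),
          Function.update_of_ne hab'.ne]
        rcases hb' with rfl | hb'
        -- Here `b'` is the new time. The induction hypothesis is applied from `a` to the latest old
        -- time `c`, and Chapman-Kolmogorov composes this with the last step from `c` to `b'`.
        · have e := hM a ha c hcm (hmax ha) K (hK' ha) g hg _ (hkf c b')
          simp_rw [← Kernel.lintegral_comp _ _ _ hf, hκ.comp a c b' (hmax ha) hcb.le] at e
          simp only [Function.update_self, lintegral_const_mul _ hf, lintegral_const, measure_univ,
            mul_one]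
          exact e
        · simp_rw [Function.update_of_ne (hlt b' hb').ne]
          simp only [lintegral_const, measure_univ, mul_one]
          exact hM a ha b' hb' hab K (hK' ha) g hg f hf

end Chain

lemma exists_probabilityMeasure_isMarkovOn_finset {T S : Type*} [LinearOrder T] [OrderBot T]
    [MeasurableSpace S] [MeasurableSingletonClass S] {κ : T → T → Kernel S S}
    (hκ : IsTransitionOn κ) (x : S) (J : Finset T) :
    ∃ P : ProbabilityMeasure (T → S), (∀ᵐ ω ∂(P : Measure (T → S)), ω ⊥ = x) ∧
      IsMarkovOn κ (J : Set T) (fun t ω => ω t) (P : Measure (T → S)) := by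
  obtain ⟨hp, hi, hM⟩ := chainLaw_isMarkovOn hκ x ((J.erase ⊥).sort (· ≥ ·))
    (Finset.sortedGT_sort _).pairwise fun t ht => by
      rw [Finset.mem_sort] at ht
      exact bot_lt_iff_ne_bot.2 (Finset.ne_of_mem_erase ht)
  refine ⟨⟨_, hp⟩, hi, hM.mono fun t ht => ?_⟩
  by_cases h : t = ⊥
  · exact Or.inl h
  · right
    simp [h, Finset.mem_coe.1 ht]

/-- Kolmogorov extension: a Markov process with given transition kernels on `[0,∞]` along a
countable set of times, started in `x`. -/
theorem exists_measure_isMarkovOn {T : Type*} [LinearOrder T] [OrderBot T] [Countable T]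
    {κ : T → T → Kernel ℝ≥0∞ ℝ≥0∞} (hκ : IsTransitionOn κ) (x : ℝ≥0∞) :
    ∃ μ : Measure (T → ℝ≥0∞), IsProbabilityMeasure μ ∧ (∀ᵐ ω ∂μ, ω ⊥ = x) ∧
      IsMarkovOn κ univ (fun t ω => ω t) μ := by
  choose P hP0 hPM using exists_probabilityMeasure_isMarkovOn_finset hκ x
  have mT : ∀ t : T, Measurable (fun ω : T → ℝ≥0∞ => ω t) := measurable_pi_apply
  have cont : ∀ K : Finset T, Continuous (fun (ω : T → ℝ≥0∞) (t : K) => ω t) := fun K =>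
    continuous_pi fun t => continuous_apply _
  -- The time `⊥` must belong to `K`: the initial value there is what pins down the
  -- finite-dimensional law.
  have consist : ∀ K J : Finset T, ⊥ ∈ K → K ⊆ J →
      (P J).map (cont K).measurable.aemeasurable = (P K).map (cont K).measurable.aemeasurable := by
    intro K J h0 hKJ
    apply Subtype.ext
    refine map_restrict_eq_of_lintegral_prod_eq (Y := fun t (ω : T → ℝ≥0∞) => ω t)
      (Y' := fun t (ω : T → ℝ≥0∞) => ω t) (fun t _ => mT t) (fun t _ => mT t) fun g hg => ?_
    exact ((hPM J).mono (Finset.coe_subset.2 hKJ)).lintegral_prod_eq (hPM K) (c := ⊥)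
      (Finset.mem_coe.2 h0) (hP0 J) (hP0 K) K (fun t ht => ⟨ht, bot_le⟩) g hg
  -- Probability measures on the compact space of functions `T → ℝ≥0∞` form a compact space, so `P`
  -- has a limit along an ultrafilter. By consistency each marginal is eventually constant along it,
  -- and the limit inherits it.
  let U : Ultrafilter (Finset T) := Ultrafilter.of atTop
  have hU : (U : Filter (Finset T)) ≤ atTop := Ultrafilter.of_le _
  let Q : ProbabilityMeasure (T → ℝ≥0∞) := (U.map P).lim
  have hQ : Tendsto P U (𝓝 Q) := (U.map P).le_nhds_lim
  have marg : ∀ K : Finset T, ⊥ ∈ K →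
      (Q : Measure (T → ℝ≥0∞)).map (fun ω (t : K) => ω t) =
        (P K : Measure (T → ℝ≥0∞)).map (fun ω (t : K) => ω t) := by
    intro K h0
    have h1 := ((ProbabilityMeasure.continuous_map (cont K)).tendsto Q).comp hQ
    have h2 : Tendsto ((fun ν : ProbabilityMeasure (T → ℝ≥0∞) =>
        ν.map (cont K).measurable.aemeasurable) ∘ P) U
        (𝓝 ((P K).map (cont K).measurable.aemeasurable)) := by
      refine tendsto_const_nhds.congr' ?_
      filter_upwards [hU (eventually_ge_atTop K)] with J hJ
      exact (consist K J h0 hJ).symm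
    have h3 := tendsto_nhds_unique h1 h2
    exact congrArg ProbabilityMeasure.toMeasure h3
  have transfer : ∀ K : Finset T, ⊥ ∈ K → ∀ F : (K → ℝ≥0∞) → ℝ≥0∞, Measurable F →
      ∫⁻ ω, F (fun t : K => ω t) ∂(Q : Measure (T → ℝ≥0∞)) =
        ∫⁻ ω, F (fun t : K => ω t) ∂(P K : Measure (T → ℝ≥0∞)) := by
    intro K h0 F hF
    have := congrArg (fun ν => ∫⁻ z, F z ∂ν) (marg K h0)
    simpa only [lintegral_map hF (cont K).measurable] using this
  refine ⟨Q, inferInstance, ?_, ?_⟩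
  · have hm : MeasurableSet {z : (({⊥} : Finset T)) → ℝ≥0∞ | z ⟨⊥, by simp⟩ = x}ᶜ :=
      (measurableSet_apply_eq _ x).compl
    have := transfer {⊥} (by simp) _ (measurable_one.indicator hm)
    rw [← lintegral_map (f := {z : (({⊥} : Finset T)) → ℝ≥0∞ | z ⟨⊥, by simp⟩ = x}ᶜ.indicator 1)
      (measurable_one.indicator hm) (cont _).measurable, lintegral_indicator_one hm,
      Measure.map_apply (cont _).measurable hm] at this
    rw [ae_iff]
    refine this.trans ?_
    rw [← lintegral_map (f := {z : (({⊥} : Finset T)) → ℝ≥0∞ | z ⟨⊥, by simp⟩ = x}ᶜ.indicator 1)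
      (measurable_one.indicator hm) (cont _).measurable, lintegral_indicator_one hm,
      Measure.map_apply (cont _).measurable hm]
    exact hP0 {⊥}
  · intro a _ b _ hab K hK g hg f hf
    classical
    set J : Finset T := insert ⊥ (insert a (insert b K)) with hJ
    have ha : a ∈ J := by simp [hJ]
    have hb : b ∈ J := by simp [hJ]
    have hKJ : ∀ t ∈ K, t ∈ J := fun t ht => by simp [hJ, ht]
    have h0 : ⊥ ∈ J := by simp [hJ]
    have hprod : ∀ ω : T → ℝ≥0∞, ∏ t ∈ K, g t (ω t) = ∏ t : K, g t (ω t) := fun ω =>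
      (Finset.prod_coe_sort K fun t => g t (ω t)).symm
    have m1 : Measurable fun z : J → ℝ≥0∞ => ∏ t : K, g t (z ⟨t, hKJ t t.2⟩) :=
      Finset.measurable_fun_prod _ fun t _ => (hg t).comp (measurable_pi_apply _)
    have e1 := transfer J h0 (fun z => (∏ t : K, g t (z ⟨t, hKJ t t.2⟩)) * f (z ⟨b, hb⟩))
      (m1.mul (hf.comp (measurable_pi_apply _)))
    have e2 := transfer J h0
      (fun z => (∏ t : K, g t (z ⟨t, hKJ t t.2⟩)) * ∫⁻ y, f y ∂(κ a b (z ⟨a, ha⟩)))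
      (m1.mul (hf.lintegral_kernel.comp (measurable_pi_apply _)))
    have e3 := hPM J a ha b hb hab K (fun t ht => ⟨hKJ t ht, (hK t ht).2⟩) g hg f hf
    simp only [hprod] at e3 ⊢
    rw [e1, e2, e3]

/-! ### Dubins' upcrossing inequality along countable sets of times -/

section Crossings

variable {T : Type*}

/-- `Crosses C k l`: running greedily through the list `l` one meets points satisfying
`C k`, `C (k - 1)`, …, `C 1`, in this order. -/
def Crosses (C : ℕ → T → Prop) : ℕ → List T → Prop
  | 0, _ => True
  | _ + 1, [] => False
  | k + 1, q :: l => (C (k + 1) q ∧ Crosses C k l) ∨ (¬ C (k + 1) q ∧ Crosses C (k + 1) l)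

/-- The points of the list satisfy `C k`, `C (k - 1)`, …, `C 1`, in this order. -/
def Alternates (C : ℕ → T → Prop) : ℕ → List T → Prop
  | 0, l => l = []
  | _ + 1, [] => False
  | k + 1, q :: l => C (k + 1) q ∧ Alternates C k l

/-- The greedy search is optimal: accepting a hit as early as possible only leaves a longer tail for
the remaining conditions. -/
lemma Alternates.crosses {C : ℕ → T → Prop} {l : List T} :
    ∀ {k : ℕ} {p : List T}, Alternates C k p → p.Sublist l → Crosses C k l := by
  induction l with
  | nil =>
    intro k p h hp
    obtain rfl := List.sublist_nil.1 hp
    cases k with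
    | zero => trivial
    | succ k => exact h.elim
  | cons q l ih =>
    intro k p h hp
    cases k with
    | zero => trivial
    | succ k =>
      cases p with
      | nil => exact h.elim
      | cons p₀ p =>
        by_cases hq : C (k + 1) q
        · refine Or.inl ⟨hq, ih h.2 ?_⟩
          cases hp with
          | cons _ hp => exact (List.sublist_cons_self _ _).trans hp
          | cons_cons _ hp => exact hp
        · refine Or.inr ⟨hq, ?_⟩
          cases hp with
          | cons _ hp => exact ih h hp
          | cons_cons _ hp => exact absurd h.1 hq

/-- There are points after `t` which satisfy `C k`, `C (k - 1)`, …, `C 1`, in this order. -/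
def AlternatesAfter [LT T] (C : ℕ → T → Prop) : ℕ → T → Prop
  | 0, _ => True
  | k + 1, t => ∃ q, t < q ∧ C (k + 1) q ∧ AlternatesAfter C k q

lemma AlternatesAfter.of_le [Preorder T] {C : ℕ → T → Prop} {k : ℕ} {s t : T} (hst : s ≤ t)
    (h : AlternatesAfter C k t) : AlternatesAfter C k s := by
  cases k with
  | zero => trivial
  | succ k =>
    obtain ⟨q, hq, h⟩ := h
    exact ⟨q, hst.trans_lt hq, h⟩

lemma AlternatesAfter.exists_list [Preorder T] {C : ℕ → T → Prop} {k : ℕ} :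
    ∀ {t : T}, AlternatesAfter C k t →
      ∃ p : List T, p.Pairwise (· < ·) ∧ (∀ q ∈ p, t < q) ∧ Alternates C k p := by
  induction k with
  | zero => exact fun _ => ⟨[], by simp, by simp, rfl⟩
  | succ k ih =>
    rintro t ⟨q, htq, hq, h⟩
    obtain ⟨p, hp, hlt, hA⟩ := ih h
    refine ⟨q :: p, List.pairwise_cons.2 ⟨hlt, hp⟩, ?_, hq, hA⟩
    intro r hr
    rcases List.mem_cons.1 hr with rfl | hr
    · exact htq
    · exact htq.trans (hlt r hr)

variable [LinearOrder T] {Ω : Type*} {F : T → MeasurableSpace Ω} {mΩ : MeasurableSpace Ω}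
  {μ : Measure Ω} {M : T → Ω → ℝ≥0∞}

/-- The condition for the successive half-crossings: reach `[0,a]` when the index is even,
reach `[b,∞]` when it is odd. -/
def crossCond (a b : ℝ≥0∞) (y : T → ℝ≥0∞) (k : ℕ) (q : T) : Prop :=
  if Odd k then b ≤ y q else y q ≤ a

/-- Induction on the list, in parallel for the two phases: waiting to fall to `a` (even index) and
waiting to rise to `b` (odd index). The set is split by whether the first point succeeds. This
replaces stopping times, and as only subadditivity is applied to the crossing events, their
measurability is never needed. -/
lemma measure_crosses_le (hF : ∀ t, F t ≤ mΩ) (hmono : Monotone F)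
    (hM : ∀ t, Measurable[F t] (M t))
    (hsup : ∀ s t, s ≤ t → ∀ A, MeasurableSet[F s] A → ∫⁻ ω in A, M t ω ∂μ ≤ ∫⁻ ω in A, M s ω ∂μ)
    (a : ℝ≥0∞) {b : ℝ≥0∞} (hb0 : b ≠ 0) (hb : b ≠ ∞) (l : List T) (hl : l.Pairwise (· < ·)) :
    (∀ n A, (∀ q ∈ l, MeasurableSet[F q] A) →
      μ (A ∩ {ω | Crosses (crossCond a b fun t => M t ω) (2 * n) l}) ≤ (a / b) ^ n * μ A) ∧
    (∀ n p A, (∀ q ∈ l, p ≤ q) → MeasurableSet[F p] A →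
      μ (A ∩ {ω | Crosses (crossCond a b fun t => M t ω) (2 * n + 1) l}) ≤
        (a / b) ^ n * (b⁻¹ * ∫⁻ ω in A, M p ω ∂μ)) := by
  induction l with
  | nil =>
    refine ⟨fun n A _ => ?_, fun n p A _ _ => by simp [Crosses]⟩
    cases n with
    | zero => simp [Crosses]
    | succ n => simp [Crosses, mul_add]
  | cons q l ih =>
    have hl' := List.pairwise_cons.1 hl
    obtain ⟨ih1, ih2⟩ := ih hl'.2
    have hqF : ∀ {A}, MeasurableSet[F q] A → ∀ r ∈ l, MeasurableSet[F r] A := fun hA r hr =>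
      hmono (hl'.1 r hr).le _ hA
    have hqle : ∀ r ∈ l, q ≤ r := fun r hr => (hl'.1 r hr).le
    have mle : MeasurableSet[F q] {ω | M q ω ≤ a} := (hM q) measurableSet_Iic
    have mge : MeasurableSet[F q] {ω | b ≤ M q ω} := (hM q) measurableSet_Ici
    constructor
    · intro n A hA
      cases n with
      | zero => simp [Crosses]
      | succ n =>
        have hAq := hA q (by simp)
        have m1 := @MeasurableSet.inter _ (F q) _ _ hAq mle
        have m2 := @MeasurableSet.inter _ (F q) _ _ hAq (@MeasurableSet.compl _ _ (F q) mle)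
        have sub : A ∩ {ω | Crosses (crossCond a b fun t => M t ω) (2 * (n + 1)) (q :: l)} ⊆
            ((A ∩ {ω | M q ω ≤ a}) ∩ {ω | Crosses (crossCond a b fun t => M t ω) (2 * n + 1) l}) ∪
            ((A ∩ {ω | M q ω ≤ a}ᶜ) ∩
              {ω | Crosses (crossCond a b fun t => M t ω) (2 * (n + 1)) l}) := by
          have hodd : ¬ Odd (Nat.mul 2 n + 1 + 1) := by simp [Nat.odd_add_one]
          rintro ω ⟨hωA, hω⟩
          rcases hω with ⟨h1, h2⟩ | ⟨h1, h2⟩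
          · rw [crossCond, if_neg hodd] at h1
            exact Or.inl ⟨⟨hωA, h1⟩, h2⟩
          · rw [crossCond, if_neg hodd] at h1
            exact Or.inr ⟨⟨hωA, h1⟩, h2⟩
        calc _ ≤ _ := measure_mono sub
          _ ≤ _ := measure_union_le _ _
          _ ≤ (a / b) ^ (n + 1) * μ (A ∩ {ω | M q ω ≤ a}) +
              (a / b) ^ (n + 1) * μ (A ∩ {ω | M q ω ≤ a}ᶜ) := by
            gcongr
            -- On the success set `M q ≤ a`, so the integral in the odd bound contributes a factor
            -- `a`; with `b⁻¹` it completes one more factor `a / b`.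
            · refine (ih2 n q _ hqle m1).trans ?_
              have : ∫⁻ ω in A ∩ {ω | M q ω ≤ a}, M q ω ∂μ ≤ a * μ (A ∩ {ω | M q ω ≤ a}) := by
                refine (setLIntegral_mono' (hF q _ m1) fun ω hω => hω.2).trans ?_
                simp
              calc _ ≤ (a / b) ^ n * (b⁻¹ * (a * μ (A ∩ {ω | M q ω ≤ a}))) := by gcongr
                _ = _ := by rw [pow_succ, ENNReal.div_eq_inv_mul]; ring
            · exact ih1 (n + 1) _ (hqF m2)
          _ = (a / b) ^ (n + 1) * μ A := by
            rw [← mul_add, ← sdiff_eq, measure_inter_add_sdiff _ (hF q _ mle)]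
    · intro n p A hpq hA
      have hpq' := hpq q (by simp)
      have hAq := hmono hpq' _ hA
      have m1 := @MeasurableSet.inter _ (F q) _ _ hAq mge
      have m2 := @MeasurableSet.inter _ (F q) _ _ hAq (@MeasurableSet.compl _ _ (F q) mge)
      have sub : A ∩ {ω | Crosses (crossCond a b fun t => M t ω) (2 * n + 1) (q :: l)} ⊆
          ((A ∩ {ω | b ≤ M q ω}) ∩ {ω | Crosses (crossCond a b fun t => M t ω) (2 * n) l}) ∪
          ((A ∩ {ω | b ≤ M q ω}ᶜ) ∩
            {ω | Crosses (crossCond a b fun t => M t ω) (2 * n + 1) l}) := by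
        have hodd : Odd (2 * n + 1) := by simp
        rintro ω ⟨hωA, hω⟩
        rcases hω with ⟨h1, h2⟩ | ⟨h1, h2⟩
        · rw [crossCond, if_pos hodd] at h1
          exact Or.inl ⟨⟨hωA, h1⟩, h2⟩
        · rw [crossCond, if_pos hodd] at h1
          exact Or.inr ⟨⟨hωA, h1⟩, h2⟩
      calc _ ≤ _ := measure_mono sub
        _ ≤ _ := measure_union_le _ _
        _ ≤ (a / b) ^ n * (b⁻¹ * ∫⁻ ω in A ∩ {ω | b ≤ M q ω}, M q ω ∂μ) +
            (a / b) ^ n * (b⁻¹ * ∫⁻ ω in A ∩ {ω | b ≤ M q ω}ᶜ, M q ω ∂μ) := by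
          gcongr
          · refine (ih1 n _ (hqF m1)).trans ?_
            gcongr
            -- Markov's inequality on the set where `M q` has reached `b`.
            rw [mul_comm, ← div_eq_mul_inv, ENNReal.le_div_iff_mul_le (Or.inl hb0) (Or.inl hb),
              mul_comm]
            calc b * μ (A ∩ {ω | b ≤ M q ω}) = ∫⁻ ω in A ∩ {ω | b ≤ M q ω}, b ∂μ := by simp
              _ ≤ _ := setLIntegral_mono' (hF q _ m1) fun ω hω => hω.2
          · exact ih2 n q _ hqle m2
        _ = (a / b) ^ n * (b⁻¹ * ∫⁻ ω in A, M q ω ∂μ) := by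
          rw [← mul_add, ← mul_add, ← sdiff_eq, lintegral_inter_add_sdiff _ _ (hF q _ mge)]
        _ ≤ _ := by
          exact mul_le_mul_right (mul_le_mul_right (hsup p q hpq' A hA) _) _

/-- Dubins' inequality for the upcrossings of a nonnegative supermartingale along a countable set of
times. -/
lemma measure_alternates_le [Countable T] [IsProbabilityMeasure μ] (hF : ∀ t, F t ≤ mΩ)
    (hmono : Monotone F) (hM : ∀ t, Measurable[F t] (M t))
    (hsup : ∀ s t, s ≤ t → ∀ A, MeasurableSet[F s] A → ∫⁻ ω in A, M t ω ∂μ ≤ ∫⁻ ω in A, M s ω ∂μ)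
    (a : ℝ≥0∞) {b : ℝ≥0∞} (hb0 : b ≠ 0) (hb : b ≠ ∞) (n : ℕ) :
    μ {ω | ∃ p : List T, p.Pairwise (· < ·) ∧
      Alternates (crossCond a b fun t => M t ω) (2 * n) p} ≤ (a / b) ^ n := by
  set E : Finset T → Set Ω := fun J => {ω | ∃ p : List T, p.Pairwise (· < ·) ∧ (∀ q ∈ p, q ∈ J) ∧
    Alternates (crossCond a b fun t => M t ω) (2 * n) p} with hE
  have hmonoE : Monotone E := by
    rintro J J' hJ ω ⟨p, hp, hpJ, hA⟩
    exact ⟨p, hp, fun q hq => hJ (hpJ q hq), hA⟩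
  have sub : {ω | ∃ p : List T, p.Pairwise (· < ·) ∧
      Alternates (crossCond a b fun t => M t ω) (2 * n) p} ⊆ ⋃ J, E J := by
    rintro ω ⟨p, hp, hA⟩
    classical
    exact mem_iUnion.2 ⟨p.toFinset, p, hp, fun q hq => List.mem_toFinset.2 hq, hA⟩
  refine (measure_mono sub).trans ?_
  rw [hmonoE.directed_le.measure_iUnion]
  refine iSup_le fun J => ?_
  have hs : (J.sort (· ≤ ·)).Pairwise (· < ·) := (Finset.sortedLT_sort J).pairwise
  have := (measure_crosses_le hF hmono hM hsup a hb0 hb (J.sort (· ≤ ·)) hs).1 n univ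
    fun q _ => @MeasurableSet.univ _ (F q)
  rw [univ_inter, measure_univ, mul_one] at this
  refine (measure_mono ?_).trans this
  rintro ω ⟨p, hp, hpJ, hA⟩
  refine hA.crosses ?_
  refine List.sublist_of_subperm_of_pairwise (r := (· < ·)) ?_ hp hs
  refine List.subperm_of_subset (hp.imp fun h => h.ne) fun q hq => ?_
  rw [Finset.mem_sort]
  exact hpJ q hq

/-- Almost surely a nonnegative supermartingale has only finitely many upcrossings. -/
lemma ae_exists_not_alternates [Countable T] [IsProbabilityMeasure μ] (hF : ∀ t, F t ≤ mΩ)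
    (hmono : Monotone F) (hM : ∀ t, Measurable[F t] (M t))
    (hsup : ∀ s t, s ≤ t → ∀ A, MeasurableSet[F s] A → ∫⁻ ω in A, M t ω ∂μ ≤ ∫⁻ ω in A, M s ω ∂μ)
    {a b : ℝ≥0∞} (hab : a < b) (hb : b ≠ ∞) :
    ∀ᵐ ω ∂μ, ∃ n, ∀ t, ¬ AlternatesAfter (crossCond a b fun t => M t ω) (2 * n) t := by
  have hb0 : b ≠ 0 := (bot_le.trans_lt hab).ne'
  rw [ae_iff]
  have hlt : a / b < 1 := ENNReal.div_lt_of_lt_mul (by simpa using hab)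
  refine le_antisymm (ge_of_tendsto' (ENNReal.tendsto_pow_atTop_nhds_zero_of_lt_one hlt)
    fun n => ?_) bot_le
  refine (measure_mono ?_).trans (measure_alternates_le hF hmono hM hsup a hb0 hb n)
  intro ω hω
  simp only [mem_ofPred_eq, not_exists, not_forall, not_not] at hω
  obtain ⟨t, ht⟩ := hω n
  obtain ⟨p, hp, -, hA⟩ := ht.exists_list
  exact ⟨p, hp, hA⟩

/-- Almost surely a nonnegative supermartingale stays close to zero once it has been very close to
zero. -/
lemma ae_exists_stays_small [Countable T] [IsProbabilityMeasure μ] (hF : ∀ t, F t ≤ mΩ)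
    (hmono : Monotone F) (hM : ∀ t, Measurable[F t] (M t))
    (hsup : ∀ s t, s ≤ t → ∀ A, MeasurableSet[F s] A → ∫⁻ ω in A, M t ω ∂μ ≤ ∫⁻ ω in A, M s ω ∂μ)
    {b : ℝ≥0∞} (hb0 : b ≠ 0) (hb : b ≠ ∞) :
    ∀ᵐ ω ∂μ, ∃ a > 0, ∀ p q : T, p < q → M p ω ≤ a → M q ω < b := by
  rw [ae_iff]
  -- The exceptional event contains an upcrossing from `1/n` to `b` for every `n`, and one such
  -- upcrossing has probability at most `(1/n) / b`.
  have lim : Tendsto (fun n : ℕ => ((n : ℝ≥0∞)⁻¹ / b) ^ 1) atTop (𝓝 0) := by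
    have := ENNReal.Tendsto.div_const (b := b) ENNReal.tendsto_inv_nat_nhds_zero (Or.inr hb0)
    simpa using this
  refine le_antisymm (ge_of_tendsto' lim fun n => ?_) bot_le
  refine (measure_mono ?_).trans (measure_alternates_le hF hmono hM hsup (n : ℝ≥0∞)⁻¹ hb0 hb 1)
  intro ω hω
  simp only [mem_ofPred_eq, not_exists, not_and, not_forall, not_lt] at hω
  obtain ⟨p, q, hpq, hp, hq⟩ := hω (n : ℝ≥0∞)⁻¹ (by simp)
  refine ⟨[p, q], by simpa using hpq, ?_, ?_, rfl⟩
  · rwa [crossCond, if_neg (by decide)]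
  · simpa [crossCond] using hq

end Crossings

/-! ### Laplace functional of branching kernels -/

/-- The function `y ↦ exp (-y)` on `[0,∞]`. -/
noncomputable def expNeg (y : ℝ≥0∞) : ℝ≥0∞ := EReal.exp (-(y : EReal))

lemma continuous_expNeg : Continuous expNeg :=
  ENNReal.continuous_exp.comp (continuous_neg.comp continuous_coe_ennreal_ereal)

lemma expNeg_zero : expNeg 0 = 1 := by simp [expNeg]

lemma expNeg_top : expNeg ∞ = 0 := by simp [expNeg]

lemma expNeg_strictAnti : StrictAnti expNeg := fun _ _ hxy =>
  EReal.exp_strictMono (EReal.neg_lt_neg_iff.2 (EReal.coe_ennreal_lt_coe_ennreal_iff.2 hxy))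

lemma expNeg_le_one (y : ℝ≥0∞) : expNeg y ≤ 1 := by
  rw [← expNeg_zero]
  exact expNeg_strictAnti.antitone bot_le

lemma expNeg_ne_top (y : ℝ≥0∞) : expNeg y ≠ ∞ := ((expNeg_le_one y).trans_lt ENNReal.one_lt_top).ne

lemma expNeg_add (x y : ℝ≥0∞) : expNeg (x + y) = expNeg x * expNeg y := by
  rw [expNeg, expNeg, expNeg, ← EReal.exp_add, EReal.coe_ennreal_add, EReal.neg_add]
  · rfl
  · exact Or.inl (EReal.coe_ennreal_ne_bot x)
  · exact Or.inr (EReal.coe_ennreal_ne_bot y)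

/-- `expNeg` as a continuous function with finite values. -/
noncomputable def expNegMap : C(ℝ≥0∞, ℝ≥0) where
  toFun y := (expNeg y).toNNReal
  continuous_toFun := continuous_iff_continuousAt.2 fun y =>
    (ENNReal.tendsto_toNNReal (expNeg_ne_top y)).comp continuous_expNeg.continuousAt

lemma coe_expNegMap (y : ℝ≥0∞) : (expNegMap y : ℝ≥0∞) = expNeg y :=
  ENNReal.coe_toNNReal (expNeg_ne_top y)

lemma expNeg_eq_one_iff {y : ℝ≥0∞} : expNeg y = 1 ↔ y = 0 := by
  rw [← expNeg_zero, expNeg_strictAnti.injective.eq_iff]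

/-- The Laplace functional of a kernel. -/
noncomputable def laplaceKernel (κ : Kernel ℝ≥0∞ ℝ≥0∞) (y : ℝ≥0∞) : ℝ≥0∞ := ∫⁻ z, expNeg z ∂(κ y)

lemma laplaceKernel_le_one (κ : Kernel ℝ≥0∞ ℝ≥0∞) [IsMarkovKernel κ] (y : ℝ≥0∞) :
    laplaceKernel κ y ≤ 1 := (lintegral_mono expNeg_le_one).trans (by simp)

lemma measurable_laplaceKernel (κ : Kernel ℝ≥0∞ ℝ≥0∞) : Measurable (laplaceKernel κ) :=
  continuous_expNeg.measurable.lintegral_kernel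

namespace IsBranchingKernelFamily

variable {k : ℝ≥0 → ℝ≥0 → Kernel ℝ≥0∞ ℝ≥0∞} (hk : IsBranchingKernelFamily k)
include hk

/-- The minimum extends the kernel integral to all pairs of times, so that continuity can be stated
on a plain product instead of the subtype of ordered pairs. -/
lemma continuous_lintegral (f : C(ℝ≥0∞, ℝ≥0)) :
    Continuous fun p : ℝ≥0 × ℝ≥0 × ℝ≥0 =>
      ∫⁻ z, f z ∂(k (min p.1 p.2.1) p.2.1 (p.2.2 : ℝ≥0∞)) := by
  have h1 := (ProbabilityMeasure.continuous_lintegral_continuousMap f).comp hk.weak_continuous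
  have h2 : Continuous fun p : ℝ≥0 × ℝ≥0 × ℝ≥0 =>
      ((⟨(min p.1 p.2.1, p.2.1), min_le_right _ _⟩, p.2.2) :
        {q : ℝ≥0 × ℝ≥0 // q.1 ≤ q.2} × ℝ≥0) := by fun_prop
  exact h1.comp h2

lemma continuous_laplaceKernel :
    Continuous fun p : ℝ≥0 × ℝ≥0 × ℝ≥0 => laplaceKernel (k (min p.1 p.2.1) p.2.1) p.2.2 := by
  simpa only [laplaceKernel, coe_expNegMap] using hk.continuous_lintegral expNegMap

lemma laplaceKernel_top {s t : ℝ≥0} (hst : s ≤ t) : laplaceKernel (k s t) ∞ = 0 := by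
  rw [laplaceKernel, hk.top s t hst, lintegral_dirac, expNeg_top]

lemma laplaceKernel_zero {s t : ℝ≥0} (hst : s ≤ t) : laplaceKernel (k s t) 0 = 1 := by
  rw [laplaceKernel, hk.zero s t hst, lintegral_dirac, expNeg_zero]

lemma laplaceKernel_self (s : ℝ≥0) (y : ℝ≥0∞) : laplaceKernel (k s s) y = expNeg y := by
  rw [laplaceKernel, hk.diag s y, lintegral_dirac]

lemma laplaceKernel_add {s t : ℝ≥0} (hst : s ≤ t) (x y : ℝ≥0) :
    laplaceKernel (k s t) ((x + y : ℝ≥0) : ℝ≥0∞) =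
      laplaceKernel (k s t) x * laplaceKernel (k s t) y := by
  have := hk.markov s t hst
  have me := continuous_expNeg.measurable
  rw [laplaceKernel, ← hk.branching s t hst x y, Measure.lintegral_conv me]
  simp_rw [expNeg_add]
  simp only [lintegral_const_mul _ me]
  rw [lintegral_mul_const _ me]
  rfl

lemma laplaceKernel_le {s t : ℝ≥0} (hst : s ≤ t) {x y : ℝ≥0∞} (hxy : x ≤ y) :
    laplaceKernel (k s t) y ≤ laplaceKernel (k s t) x := by
  have := hk.markov s t hst
  induction y with
  | top => rw [hk.laplaceKernel_top hst]; exact bot_le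
  | coe y =>
    lift x to ℝ≥0 using (hxy.trans_lt ENNReal.coe_lt_top).ne
    have h := hk.laplaceKernel_add hst x (y - x)
    rw [add_tsub_cancel_of_le (ENNReal.coe_le_coe.1 hxy)] at h
    rw [h]
    exact mul_le_of_le_one_right' (laplaceKernel_le_one _ _)

lemma laplaceKernel_nat {s t : ℝ≥0} (hst : s ≤ t) (x : ℝ≥0) (n : ℕ) :
    laplaceKernel (k s t) ((n * x : ℝ≥0) : ℝ≥0∞) = laplaceKernel (k s t) x ^ n := by
  induction n with
  | zero => simp [hk.laplaceKernel_zero hst]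
  | succ n ih =>
    have : ((n + 1 : ℕ) : ℝ≥0) * x = n * x + x := by push_cast; ring
    rw [this, hk.laplaceKernel_add hst, ih, pow_succ]

/-- By multiplicativity a zero at `x` would be a zero at every `x / (n + 1)`, contradicting
continuity at the starting point 0, where the value is 1. -/
lemma laplaceKernel_ne_zero {s t : ℝ≥0} (hst : s ≤ t) (x : ℝ≥0) :
    laplaceKernel (k s t) x ≠ 0 := by
  intro h
  have h0 : ∀ n : ℕ, laplaceKernel (k s t) ((x / (n + 1) : ℝ≥0) : ℝ≥0∞) = 0 := by
    intro n
    have := hk.laplaceKernel_nat hst (x / (n + 1)) (n + 1)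
    have e : ((n + 1 : ℕ) : ℝ≥0) * (x / (n + 1)) = x := by
      push_cast
      exact mul_div_cancel₀ _ (by positivity)
    rw [e, h] at this
    exact pow_eq_zero_iff (by simp) |>.1 this.symm
  have hc := hk.continuous_laplaceKernel
  have hlim : Tendsto (fun n : ℕ => x / ((n : ℝ≥0) + 1)) atTop (𝓝 0) := by
    have := (tendsto_inv_atTop_nhds_zero_nat (𝕜 := ℝ≥0) |>.comp (tendsto_add_atTop_nat 1)).const_mul x
    simpa [div_eq_mul_inv, Function.comp_def] using this
  have h1 : Tendsto (fun n : ℕ => laplaceKernel (k s t) ((x / (n + 1) : ℝ≥0) : ℝ≥0∞)) atTop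
      (𝓝 (laplaceKernel (k s t) ((0 : ℝ≥0) : ℝ≥0∞))) := by
    have := (hc.tendsto (s, t, 0)).comp
      (tendsto_const_nhds.prodMk_nhds (tendsto_const_nhds.prodMk_nhds hlim) :
        Tendsto (fun n : ℕ => (s, t, x / ((n : ℝ≥0) + 1))) atTop (𝓝 (s, t, 0)))
    simpa [Function.comp_def, min_eq_left hst] using this
  simp_rw [h0] at h1
  rw [ENNReal.coe_zero, hk.laplaceKernel_zero hst] at h1
  exact zero_ne_one (tendsto_nhds_unique tendsto_const_nhds h1)

/-- If the Laplace functional equals one somewhere on `(0,∞)`, it equals one on `[0,∞)`. -/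
lemma laplaceKernel_eq_one {s t : ℝ≥0} (hst : s ≤ t) {x : ℝ≥0} (hx : x ≠ 0)
    (h : laplaceKernel (k s t) x = 1) (y : ℝ≥0) : laplaceKernel (k s t) y = 1 := by
  have := hk.markov s t hst
  refine le_antisymm (laplaceKernel_le_one _ _) ?_
  obtain ⟨n, hn⟩ := exists_nat_ge (y / x)
  have hy : y ≤ n * x := (div_le_iff₀ (pos_iff_ne_zero.2 hx)).1 hn
  calc (1 : ℝ≥0∞) = laplaceKernel (k s t) ((n * x : ℝ≥0) : ℝ≥0∞) := by
        rw [hk.laplaceKernel_nat hst, h, one_pow]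
    _ ≤ _ := hk.laplaceKernel_le hst (ENNReal.coe_le_coe.2 hy)

/-- The value 1 means certain extinction by time `t`. Let `r` be the first time by which extinction
from time `s` is certain. For `q` in `[s, r)` extinction by `q` is not certain, so it must be
certain between `q` and `r`. Letting `q` tend to `r` makes extinction certain over a time interval
of length zero, which is absurd. -/
lemma laplaceKernel_one_lt_one {s t : ℝ≥0} (hst : s ≤ t) :
    laplaceKernel (k s t) (1 : ℝ≥0) < 1 := by
  have hle : ∀ {s t : ℝ≥0}, s ≤ t → ∀ y, laplaceKernel (k s t) y ≤ 1 := fun h y =>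
    have := hk.markov _ _ h
    laplaceKernel_le_one _ y
  have hself : ∀ r, laplaceKernel (k r r) (1 : ℝ≥0) ≠ 1 := by
    intro r h
    rw [hk.laplaceKernel_self, expNeg_eq_one_iff] at h
    simp at h
  refine lt_of_le_of_ne (hle hst _) fun heq => ?_
  have hc := hk.continuous_laplaceKernel
  set R : Set ℝ≥0 := {r | s ≤ r ∧ laplaceKernel (k (min s r) r) (1 : ℝ≥0) = 1} with hR
  have hRc : IsClosed R := by
    refine IsClosed.inter isClosed_Ici (isClosed_eq ?_ continuous_const)
    exact hc.comp (f := fun r : ℝ≥0 => (s, r, (1 : ℝ≥0))) (by fun_prop)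
  have hRne : R.Nonempty := ⟨t, hst, by rwa [min_eq_left hst]⟩
  have hmem : sInf R ∈ R := hRc.csInf_mem hRne ⟨0, fun _ _ => zero_le⟩
  set r := sInf R with hr
  obtain ⟨hsr, h1⟩ := hmem
  rw [min_eq_left hsr] at h1
  have hne : s ≠ r := by
    rintro h
    rw [← h] at h1
    exact hself s h1
  have dead : ∀ q ∈ Ico s r, laplaceKernel (k q r) (1 : ℝ≥0) = 1 := by
    rintro q ⟨hsq, hqr⟩
    have := hk.markov s q hsq
    by_contra hq
    have hiff : ∀ y, laplaceKernel (k q r) y = 1 → y = 0 := by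
      intro y hy
      by_contra hy0
      induction y with
      | top => simp [hk.laplaceKernel_top hqr.le] at hy
      | coe y =>
        exact hq (hk.laplaceKernel_eq_one hqr.le (by simpa using hy0) hy 1)
    have e1 : ∫⁻ y, laplaceKernel (k q r) y ∂(k s q ((1 : ℝ≥0) : ℝ≥0∞)) = 1 := by
      rw [← h1, laplaceKernel, ← hk.chapman_kolmogorov s q r hsq hqr.le,
        Kernel.lintegral_comp _ _ _ continuous_expNeg.measurable]
      rfl
    have e2 : ∀ᵐ y ∂(k s q ((1 : ℝ≥0) : ℝ≥0∞)), laplaceKernel (k q r) y = 1 := by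
      have := ae_eq_of_ae_le_of_lintegral_le (μ := k s q ((1 : ℝ≥0) : ℝ≥0∞))
        (f := laplaceKernel (k q r)) (g := fun _ => 1) (ae_of_all _ fun y => hle hqr.le y)
        (by rw [e1]; simp) aemeasurable_const (by rw [e1]; simp)
      exact this
    have e3 : laplaceKernel (k s q) ((1 : ℝ≥0) : ℝ≥0∞) = 1 := by
      rw [laplaceKernel, lintegral_congr_ae (g := fun _ => 1)]
      · simp
      · filter_upwards [e2] with y hy
        rw [hiff y hy, expNeg_zero]
    have hqR : q ∈ R := ⟨hsq, by rwa [min_eq_left hsq]⟩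
    exact notMem_of_lt_csInf (hr ▸ hqr) ⟨0, fun _ _ => zero_le⟩ hqR
  have hcl : IsClosed {q | laplaceKernel (k (min q r) r) (1 : ℝ≥0) = 1} := by
    refine isClosed_eq ?_ continuous_const
    exact hc.comp (f := fun q : ℝ≥0 => (q, r, (1 : ℝ≥0))) (by fun_prop)
  have hsub : Icc s r ⊆ {q | laplaceKernel (k (min q r) r) (1 : ℝ≥0) = 1} := by
    rw [← closure_Ico hne]
    refine hcl.closure_subset_iff.2 fun q hq => ?_
    simpa [min_eq_left hq.2.le] using dead q hq
  have := hsub (right_mem_Icc.2 hsr)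
  rw [mem_ofPred_eq, min_self] at this
  exact hself r this

lemma laplaceKernel_lt {s t : ℝ≥0} (hst : s ≤ t) {x y : ℝ≥0∞} (hxy : x < y) :
    laplaceKernel (k s t) y < laplaceKernel (k s t) x := by
  have := hk.markov s t hst
  lift x to ℝ≥0 using (hxy.trans_le le_top).ne
  have hx := hk.laplaceKernel_ne_zero hst x
  induction y with
  | top =>
    rw [hk.laplaceKernel_top hst]
    exact pos_iff_ne_zero.2 hx
  | coe y =>
    have hxy' := ENNReal.coe_lt_coe.1 hxy
    have h := hk.laplaceKernel_add hst x (y - x)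
    rw [add_tsub_cancel_of_le hxy'.le] at h
    have hlt : laplaceKernel (k s t) ((y - x : ℝ≥0) : ℝ≥0∞) < 1 := by
      refine lt_of_le_of_ne (laplaceKernel_le_one _ _) fun h1 => ?_
      exact (hk.laplaceKernel_one_lt_one hst).ne
        (hk.laplaceKernel_eq_one hst (tsub_pos_of_lt hxy').ne' h1 1)
    rw [h]
    calc _ < laplaceKernel (k s t) x * 1 :=
          (ENNReal.mul_lt_mul_iff_right hx
            ((laplaceKernel_le_one _ _).trans_lt ENNReal.one_lt_top).ne).2 hlt
      _ = _ := mul_one _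

lemma laplaceKernel_injective {s t : ℝ≥0} (hst : s ≤ t) :
    Function.Injective (laplaceKernel (k s t)) :=
  StrictAnti.injective fun _ _ h => hk.laplaceKernel_lt hst h

/-- The Laplace functional is jointly continuous in the starting time and the starting point, the
latter ranging over all of `[0,∞]`. -/
lemma continuous_laplaceKernel_left (t : ℝ≥0) :
    Continuous fun p : ℝ≥0 × ℝ≥0∞ => laplaceKernel (k (min p.1 t) t) p.2 := by
  have hc : Continuous fun p : ℝ≥0 × ℝ≥0 => laplaceKernel (k (min p.1 t) t) p.2 :=
    hk.continuous_laplaceKernel.comp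
      (by fun_prop : Continuous fun p : ℝ≥0 × ℝ≥0 => (p.1, t, p.2))
  refine continuous_iff_continuousAt.2 ?_
  rintro ⟨s, y⟩
  induction y with
  | coe y =>
    have emb : Topology.IsOpenEmbedding (Prod.map id ((↑) : ℝ≥0 → ℝ≥0∞) : ℝ≥0 × ℝ≥0 → ℝ≥0 × ℝ≥0∞) :=
      Topology.IsOpenEmbedding.id.prodMap ENNReal.isOpenEmbedding_coe
    exact (emb.continuousAt_iff (x := (s, y))).1 (hc.continuousAt (x := (s, y)))
  | top =>
    rw [ContinuousAt, hk.laplaceKernel_top (min_le_right _ _), ENNReal.tendsto_nhds_zero]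
    intro ε hε
    -- For starting times near `s` and starting points above `n`, multiplicativity gives the uniform
    -- bound `c ^ n`, since the value at 1 stays below `c < 1`.
    obtain ⟨c, hc1, hc2⟩ := exists_between (hk.laplaceKernel_one_lt_one (min_le_right s t))
    obtain ⟨n, hn⟩ := ((ENNReal.tendsto_pow_atTop_nhds_zero_of_lt_one hc2).eventually
      (gt_mem_nhds hε)).exists
    have h1 : ∀ᶠ q in 𝓝 s, laplaceKernel (k (min q t) t) (1 : ℝ≥0) < c :=
      (hc.comp (by fun_prop : Continuous fun q : ℝ≥0 => (q, (1 : ℝ≥0)))).continuousAt.eventually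
        (gt_mem_nhds hc1)
    have h2 : ∀ᶠ y : ℝ≥0∞ in 𝓝 ∞, (n : ℝ≥0∞) < y := lt_mem_nhds (ENNReal.natCast_lt_top n)
    rw [nhds_prod_eq]
    filter_upwards [h1.prod_mk h2] with p hp
    calc laplaceKernel (k (min p.1 t) t) p.2
        ≤ laplaceKernel (k (min p.1 t) t) ((n * 1 : ℝ≥0) : ℝ≥0∞) :=
          hk.laplaceKernel_le (min_le_right _ _) (by simpa using hp.2.le)
      _ = laplaceKernel (k (min p.1 t) t) (1 : ℝ≥0) ^ n :=
          hk.laplaceKernel_nat (min_le_right _ _) 1 n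
      _ ≤ c ^ n := by gcongr; exact hp.1.le
      _ ≤ ε := hn.le

end IsBranchingKernelFamily

/-! ### Almost sure regularity along the rational times -/

lemma measurable_indicator_one_of {α : Type*} {m : MeasurableSpace α} {A : Set α}
    (hA : MeasurableSet A) : Measurable (A.indicator (1 : α → ℝ≥0∞)) :=
  measurable_one.indicator hA

/-- Rational times approaching `t` from the right. -/
def ratRight (t : ℝ≥0) : Filter ℚ≥0 := comap (fun q : ℚ≥0 => (q : ℝ≥0)) (𝓝[>] t)

/-- Rational times approaching `t` from the left. -/
def ratLeft (t : ℝ≥0) : Filter ℚ≥0 := comap (fun q : ℚ≥0 => (q : ℝ≥0)) (𝓝[<] t)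

lemma exists_nnrat_btwn {s t : ℝ≥0} (h : s < t) : ∃ q : ℚ≥0, s < q ∧ (q : ℝ≥0) < t := by
  obtain ⟨q, h1, h2⟩ := exists_rat_btwn (NNReal.coe_lt_coe.2 h)
  have hq : (0 : ℚ) ≤ q := by
    have : (0 : ℝ) ≤ q := s.coe_nonneg.trans h1.le
    exact_mod_cast this
  obtain ⟨p, rfl⟩ : ∃ p : ℚ≥0, (p : ℚ) = q := ⟨⟨q, hq⟩, rfl⟩
  have e : ((p : ℚ) : ℝ) = ((p : ℝ≥0) : ℝ) := by
    change ((p : ℚ) : ℝ) = (p : ℝ)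
    norm_cast
  rw [e] at h1 h2
  exact ⟨p, NNReal.coe_lt_coe.1 h1, NNReal.coe_lt_coe.1 h2⟩

lemma tendsto_cast_ratRight (t : ℝ≥0) :
    Tendsto (fun q : ℚ≥0 => (q : ℝ≥0)) (ratRight t) (𝓝[>] t) := tendsto_comap

lemma tendsto_cast_ratLeft (t : ℝ≥0) :
    Tendsto (fun q : ℚ≥0 => (q : ℝ≥0)) (ratLeft t) (𝓝[<] t) := tendsto_comap

lemma hasBasis_ratRight (t : ℝ≥0) :
    (ratRight t).HasBasis (fun u => t < u) fun u => {q : ℚ≥0 | t < q ∧ (q : ℝ≥0) < u} := by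
  simpa using! (nhdsGT_basis t).comap (fun q : ℚ≥0 => (q : ℝ≥0))

lemma hasBasis_ratLeft {t : ℝ≥0} (ht : 0 < t) :
    (ratLeft t).HasBasis (fun u => u < t) fun u => {q : ℚ≥0 | u < q ∧ (q : ℝ≥0) < t} := by
  simpa using! (nhdsLT_basis_of_exists_lt ⟨0, ht⟩).comap (fun q : ℚ≥0 => (q : ℝ≥0))

instance (t : ℝ≥0) : (ratRight t).NeBot :=
  (hasBasis_ratRight t).neBot_iff.2 fun h => exists_nnrat_btwn h

lemma ratLeft_neBot {t : ℝ≥0} (ht : 0 < t) : (ratLeft t).NeBot :=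
  (hasBasis_ratLeft ht).neBot_iff.2 fun h => exists_nnrat_btwn h

lemma ratLeft_zero : ratLeft 0 = ⊥ := by
  simp [ratLeft]

section Deterministic

variable {z : ℚ≥0 → ℝ≥0∞} {a b : ℝ≥0∞}

/-- Times accumulate at `t` from the right, so the crossings are built backwards: each new one is
placed before those already found. On the left of `t` they are built forwards. -/
lemma alternatesAfter_ratRight {t : ℝ≥0} (ha : ∃ᶠ q in ratRight t, z q < a)
    (hb : ∃ᶠ q in ratRight t, b < z q) (n : ℕ) :
    ∃ r : ℚ≥0, t < r ∧ AlternatesAfter (crossCond a b z) (2 * n) r := by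
  have between : ∀ r : ℚ≥0, t < r → {q : ℚ≥0 | t < q ∧ (q : ℝ≥0) < r} ∈ ratRight t := fun r hr =>
    (hasBasis_ratRight t).mem_of_mem hr
  induction n with
  | zero =>
    obtain ⟨r, hr, -⟩ := exists_nnrat_btwn (lt_add_one t)
    exact ⟨r, hr, trivial⟩
  | succ n ih =>
    obtain ⟨r, htr, hr⟩ := ih
    obtain ⟨q, hq, htq, hqr⟩ := (hb.and_eventually (between r htr)).exists
    obtain ⟨p, hp, htp, hpq⟩ := (ha.and_eventually (between q htq)).exists
    obtain ⟨s, hts, hsp⟩ := exists_nnrat_btwn htp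
    refine ⟨s, hts, p, NNRat.cast_lt.1 hsp, ?_, q, NNRat.cast_lt.1 hpq, ?_,
      hr.of_le (NNRat.cast_lt.1 hqr).le⟩
    · rw [crossCond, if_neg (by simp [Nat.odd_add_one])]
      exact hp.le
    · rw [crossCond, if_pos (by simp)]
      exact hq.le

lemma alternatesAfter_ratLeft {t : ℝ≥0} (ht : 0 < t) (ha : ∃ᶠ q in ratLeft t, z q < a)
    (hb : ∃ᶠ q in ratLeft t, b < z q) (n : ℕ) :
    ∀ r : ℚ≥0, (r : ℝ≥0) < t → AlternatesAfter (crossCond a b z) (2 * n) r := by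
  have between : ∀ r : ℚ≥0, r < t → {q : ℚ≥0 | (r : ℝ≥0) < q ∧ (q : ℝ≥0) < t} ∈ ratLeft t :=
    fun r hr => (hasBasis_ratLeft ht).mem_of_mem hr
  induction n with
  | zero => exact fun _ _ => trivial
  | succ n ih =>
    intro r hr
    obtain ⟨p, hp, hrp, hpt⟩ := (ha.and_eventually (between r hr)).exists
    obtain ⟨q, hq, hpq, hqt⟩ := (hb.and_eventually (between p hpt)).exists
    refine ⟨p, NNRat.cast_lt.1 hrp, ?_, q, NNRat.cast_lt.1 hpq, ?_, ih q hqt⟩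
    · rw [crossCond, if_neg (by simp [Nat.odd_add_one])]
      exact hp.le
    · rw [crossCond, if_pos (by simp)]
      exact hq.le

/-- A function on the rationals with finitely many upcrossings has one-sided limits. -/
lemma exists_tendsto_of_not_alternates {s : Set ℝ≥0∞} (hs : Dense s)
    (h : ∀ a ∈ s, ∀ b ∈ s, a < b → ∃ n, ∀ t, ¬ AlternatesAfter (crossCond a b z) (2 * n) t)
    (t : ℝ≥0) :
    (∃ l, Tendsto z (ratRight t) (𝓝 l)) ∧ ∃ l, Tendsto z (ratLeft t) (𝓝 l) := by
  constructor
  · refine tendsto_of_no_upcrossings hs fun a ha b hb hab hf => ?_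
    obtain ⟨n, hn⟩ := h a ha b hb hab
    obtain ⟨r, -, hr⟩ := alternatesAfter_ratRight hf.1 hf.2 n
    exact hn r hr
  · rcases eq_or_ne t 0 with rfl | ht
    · exact ⟨0, by simp [ratLeft_zero]⟩
    have ht := pos_iff_ne_zero.2 ht
    refine tendsto_of_no_upcrossings hs fun a ha b hb hab hf => ?_
    obtain ⟨n, hn⟩ := h a ha b hb hab
    obtain ⟨r, -, hr⟩ := exists_nnrat_btwn ht
    exact hn r (alternatesAfter_ratLeft ht hf.1 hf.2 n r hr)

end Deterministic

/-- Regularity of a path along the rationals: it has one-sided limits and is absorbed at `0` and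
at `∞`. -/
structure IsRegularPath (y : ℚ≥0 → ℝ≥0∞) : Prop where
  right : ∀ t, ∃ l, Tendsto y (ratRight t) (𝓝 l)
  left : ∀ t, ∃ l, Tendsto y (ratLeft t) (𝓝 l)
  absorbed : ∀ r : ℝ≥0∞, r = 0 ∨ r = ∞ → ∀ (L : Filter ℚ≥0) [L.NeBot] (t : ℝ≥0) (q : ℚ≥0),
    Tendsto (fun p : ℚ≥0 => (p : ℝ≥0)) L (𝓝 t) → (∀ᶠ p in L, p < q) → Tendsto y L (𝓝 r) → y q = r

/-- The Laplace martingale with time horizon `T`, as a function of the path. -/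
noncomputable def laplaceMartingale (k : ℝ≥0 → ℝ≥0 → Kernel ℝ≥0∞ ℝ≥0∞) (T q : ℚ≥0)
    (y : ℚ≥0 → ℝ≥0∞) : ℝ≥0∞ :=
  laplaceKernel (k (min q T : ℚ≥0) T) (y (min q T))

/-- The past of the coordinate process at time `q`. -/
abbrev ratPast (q : ℚ≥0) : MeasurableSpace (ℚ≥0 → ℝ≥0∞) :=
  ⨆ t ∈ univ ∩ Iic q, MeasurableSpace.comap (fun ω : ℚ≥0 → ℝ≥0∞ => ω t) inferInstance

lemma ratPast_mono : Monotone ratPast := fun _ _ h =>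
  biSup_mono fun _ hr => ⟨hr.1, hr.2.trans h⟩

lemma ratPast_le (q : ℚ≥0) : ratPast q ≤ MeasurableSpace.pi :=
  iSup₂_le fun t _ => (measurable_pi_apply t).comap_le

lemma measurable_ratPast {p q : ℚ≥0} (h : p ≤ q) :
    Measurable[ratPast q] (fun ω : ℚ≥0 → ℝ≥0∞ => ω p) :=
  measurable_iff_comap_le.2 (le_iSup₂_of_le p ⟨mem_univ p, h⟩ le_rfl)

namespace IsBranchingKernelFamily

variable {k : ℝ≥0 → ℝ≥0 → Kernel ℝ≥0∞ ℝ≥0∞} (hk : IsBranchingKernelFamily k)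
include hk

lemma isTransitionOn_rat : IsTransitionOn fun p q : ℚ≥0 => k p q where
  markov s t hst := hk.markov s t (NNRat.cast_le.2 hst)
  diag s x := hk.diag s x
  comp s t u hst htu := hk.chapman_kolmogorov s t u (NNRat.cast_le.2 hst) (NNRat.cast_le.2 htu)

omit hk in
lemma measurable_laplaceMartingale (T q : ℚ≥0) :
    Measurable[ratPast q] (laplaceMartingale k T q) :=
  (measurable_laplaceKernel _).comp (measurable_ratPast (min_le_left q T))

lemma laplaceMartingale_le_one (T q : ℚ≥0) (y : ℚ≥0 → ℝ≥0∞) : laplaceMartingale k T q y ≤ 1 :=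
  have := hk.markov (min q T : ℚ≥0) T (NNRat.cast_le.2 (min_le_right q T))
  laplaceKernel_le_one _ _

/-- The Markov property replaces the Laplace functional at time `q` by its average under the kernel
from `p` to `q`, which Chapman-Kolmogorov identifies with the functional at time `p`. Past the
horizon the process is frozen. -/
lemma setLIntegral_laplaceMartingale {μ : Measure (ℚ≥0 → ℝ≥0∞)} [IsProbabilityMeasure μ]
    (hμ : IsMarkovOn (fun p q : ℚ≥0 => k p q) univ (fun t ω => ω t) μ) (T : ℚ≥0) {p q : ℚ≥0}
    (hpq : p ≤ q) {A : Set (ℚ≥0 → ℝ≥0∞)} (hA : MeasurableSet[ratPast p] A) :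
    ∫⁻ ω in A, laplaceMartingale k T q ω ∂μ = ∫⁻ ω in A, laplaceMartingale k T p ω ∂μ := by
  rcases le_total T p with hT | hT
  · simp_rw [laplaceMartingale, min_eq_right hT, min_eq_right (hT.trans hpq)]
  · have hpq' : p ≤ min q T := le_min hpq hT
    have hqT := min_le_right q T
    have := hk.markov (min q T : ℚ≥0) T (NNRat.cast_le.2 hqT)
    have hA' := ratPast_le p A hA
    have hG : Measurable[ratPast p] (A.indicator (1 : (ℚ≥0 → ℝ≥0∞) → ℝ≥0∞)) :=
      measurable_indicator_one_of hA
    have key := hμ.lintegral_mul hk.isTransitionOn_rat (fun t _ => measurable_pi_apply t)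
      (mem_univ p) (mem_univ (min q T)) hpq' (m := ratPast p) rfl hG
      (measurable_laplaceKernel (k (min q T : ℚ≥0) T)) (C := 1)
      (fun y => (laplaceKernel_le_one _ y).trans_eq ENNReal.coe_one.symm)
    have e : ∀ φ : (ℚ≥0 → ℝ≥0∞) → ℝ≥0∞, ∫⁻ ω in A, φ ω ∂μ =
        ∫⁻ ω, A.indicator (1 : (ℚ≥0 → ℝ≥0∞) → ℝ≥0∞) ω * φ ω ∂μ := by
      intro φ
      rw [← lintegral_indicator hA']
      congr 1 with ω
      by_cases h : ω ∈ A <;> simp [h]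
    rw [e, e]
    refine key.trans (lintegral_congr fun ω => ?_)
    congr 1
    simp only [laplaceMartingale, min_eq_left hT]
    rw [laplaceKernel, ← hk.chapman_kolmogorov p (min q T : ℚ≥0) T (NNRat.cast_le.2 hpq')
      (NNRat.cast_le.2 hqT), Kernel.lintegral_comp _ _ _ continuous_expNeg.measurable]
    rfl

lemma continuousAt_laplaceMartingale {T : ℚ≥0} {L : Filter ℚ≥0} {t : ℝ≥0} {r : ℝ≥0∞}
    {y : ℚ≥0 → ℝ≥0∞} (hL : Tendsto (fun p : ℚ≥0 => (p : ℝ≥0)) L (𝓝 t)) (hT : ∀ᶠ p in L, p < T)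
    (hy : Tendsto y L (𝓝 r)) :
    Tendsto (fun q => laplaceMartingale k T q y) L (𝓝 (laplaceKernel (k (min t T) T) r)) := by
  have := ((hk.continuous_laplaceKernel_left T).tendsto (t, r)).comp (hL.prodMk_nhds hy)
  refine this.congr' ?_
  filter_upwards [hT] with p hp
  simp only [laplaceMartingale, min_eq_left hp.le, Function.comp_apply]
  rw [min_eq_left (NNRat.cast_le.2 hp.le)]

/-- By joint continuity every cluster point of `y` has the same Laplace functional `l`. Injectivity
leaves only one cluster point, and in the compact space `[0,∞]` this means convergence. -/
lemma exists_tendsto_of_laplaceMartingale {T : ℚ≥0} {L : Filter ℚ≥0} {t : ℝ≥0}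
    {y : ℚ≥0 → ℝ≥0∞} (hL : Tendsto (fun p : ℚ≥0 => (p : ℝ≥0)) L (𝓝 t)) (hT : ∀ᶠ p in L, p < T)
    {l : ℝ≥0∞} (hl : Tendsto (fun q => laplaceMartingale k T q y) L (𝓝 l)) :
    ∃ r, Tendsto y L (𝓝 r) := by
  rcases L.eq_or_neBot with rfl | hL0
  · exact ⟨0, by simp⟩
  have key : ∀ r, MapClusterPt r L y → laplaceKernel (k (min t T) T) r = l := by
    intro r hr
    obtain ⟨U, hU, hUr⟩ := mapClusterPt_iff_ultrafilter.1 hr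
    exact tendsto_nhds_unique (hk.continuousAt_laplaceMartingale (hL.mono_left hU)
      (hU hT) hUr) (hl.mono_left hU)
  obtain ⟨r, hr⟩ := exists_clusterPt_of_compactSpace (map y L)
  refine ⟨r, le_nhds_of_unique_clusterPt fun r' hr' => ?_⟩
  exact hk.laplaceKernel_injective (min_le_right t T) ((key r' hr').trans (key r hr).symm)

/-- Almost every trajectory of the Markov process along the rationals is regular. -/
theorem ae_isRegularPath {μ : Measure (ℚ≥0 → ℝ≥0∞)} [IsProbabilityMeasure μ]
    (hμ : IsMarkovOn (fun p q : ℚ≥0 => k p q) univ (fun t ω => ω t) μ) :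
    ∀ᵐ y ∂μ, IsRegularPath y := by
  obtain ⟨s, hsc, hsd, -, hst⟩ := ENNReal.exists_countable_dense_no_zero_top
  have hM := fun T : ℚ≥0 => fun q => measurable_laplaceMartingale (k := k) T q
  have hsup := fun T : ℚ≥0 => fun p q hpq A hA =>
    (hk.setLIntegral_laplaceMartingale hμ T (p := p) (q := q) hpq (A := A) hA).le
  have hM' : ∀ T q : ℚ≥0, Measurable[ratPast q] fun y => 1 - laplaceMartingale k T q y :=
    fun T q => (hM T q).const_sub 1
  have hsup' : ∀ T p q : ℚ≥0, p ≤ q → ∀ A, MeasurableSet[ratPast p] A →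
      ∫⁻ y in A, (1 - laplaceMartingale k T q y) ∂μ ≤
        ∫⁻ y in A, (1 - laplaceMartingale k T p y) ∂μ := by
    intro T p q hpq A hA
    have e : ∀ q, ∫⁻ y in A, (1 - laplaceMartingale k T q y) ∂μ =
        ∫⁻ y in A, 1 ∂μ - ∫⁻ y in A, laplaceMartingale k T q y ∂μ := by
      intro q
      refine lintegral_sub ((hM T q).mono (ratPast_le q) le_rfl) ?_
        (ae_of_all _ fun y => hk.laplaceMartingale_le_one T q y)
      refine ((lintegral_mono fun y => hk.laplaceMartingale_le_one T q y).trans_lt ?_).ne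
      simp
    rw [e, e, hk.setLIntegral_laplaceMartingale hμ T hpq hA]
  have h1 : ∀ᵐ y ∂μ, ∀ T : ℚ≥0, ∀ a ∈ s, ∀ b ∈ s, a < b →
      ∃ n, ∀ t, ¬ AlternatesAfter (crossCond a b fun q => laplaceMartingale k T q y) (2 * n) t := by
    rw [ae_all_iff]
    intro T
    rw [ae_ball_iff hsc]
    intro a ha
    rw [ae_ball_iff hsc]
    intro b hb
    rw [ae_all_iff]
    intro hab
    exact ae_exists_not_alternates ratPast_le ratPast_mono (hM T) (hsup T) hab
      (fun h => hst (h ▸ hb))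
  have hj : ∀ j : ℕ, ((j : ℝ≥0∞) + 1)⁻¹ ≠ 0 ∧ ((j : ℝ≥0∞) + 1)⁻¹ ≠ ∞ := fun j => by simp
  have h2 : ∀ᵐ y ∂μ, ∀ T : ℚ≥0, ∀ j : ℕ, ∃ a > 0, ∀ p q : ℚ≥0, p < q →
      laplaceMartingale k T p y ≤ a → laplaceMartingale k T q y < ((j : ℝ≥0∞) + 1)⁻¹ := by
    simp_rw [ae_all_iff]
    exact fun T j => ae_exists_stays_small ratPast_le ratPast_mono (hM T) (hsup T) (hj j).1 (hj j).2
  have h3 : ∀ᵐ y ∂μ, ∀ T : ℚ≥0, ∀ j : ℕ, ∃ a > 0, ∀ p q : ℚ≥0, p < q →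
      1 - laplaceMartingale k T p y ≤ a → 1 - laplaceMartingale k T q y < ((j : ℝ≥0∞) + 1)⁻¹ := by
    simp_rw [ae_all_iff]
    exact fun T j =>
      ae_exists_stays_small ratPast_le ratPast_mono (hM' T) (hsup' T) (hj j).1 (hj j).2
  have small : ∀ x : ℝ≥0∞, (∀ j : ℕ, x < ((j : ℝ≥0∞) + 1)⁻¹) → x = 0 := by
    intro x hx
    by_contra h
    obtain ⟨n, hn⟩ := ENNReal.exists_inv_nat_lt h
    exact absurd (hx n) (not_lt.2 ((ENNReal.inv_le_inv.2 (by simp)).trans hn.le))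
  filter_upwards [h1, h2, h3] with y hy1 hy2 hy3
  refine ⟨fun t => ?_, fun t => ?_, ?_⟩
  · obtain ⟨T, hT, -⟩ := exists_nnrat_btwn (lt_add_one t)
    obtain ⟨l, hl⟩ := (exists_tendsto_of_not_alternates hsd (hy1 T) t).1
    refine hk.exists_tendsto_of_laplaceMartingale
      ((tendsto_cast_ratRight t).mono_right nhdsWithin_le_nhds) ?_ hl
    filter_upwards [(hasBasis_ratRight t).mem_of_mem hT] with p hp
    exact NNRat.cast_lt.1 hp.2
  · obtain ⟨T, hT, -⟩ := exists_nnrat_btwn (lt_add_one t)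
    obtain ⟨l, hl⟩ := (exists_tendsto_of_not_alternates hsd (hy1 T) t).2
    refine hk.exists_tendsto_of_laplaceMartingale
      ((tendsto_cast_ratLeft t).mono_right nhdsWithin_le_nhds) ?_ hl
    filter_upwards [(tendsto_cast_ratLeft t).eventually self_mem_nhdsWithin] with p hp
    exact NNRat.cast_lt.1 (lt_trans hp hT)
  · intro r hr L _ t q hL hLq hLr
    have lim := hk.continuousAt_laplaceMartingale hL hLq hLr
    -- With horizon `q` the martingale ends at `exp (-y q)`. Approaching 0 or 1 before `q` forces
    -- this end value to be 0 or 1, that is, `y q` to be `∞` or 0.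
    have self : laplaceMartingale k q q y = expNeg (y q) := by
      simp only [laplaceMartingale, min_self]
      exact hk.laplaceKernel_self _ _
    rcases hr with rfl | rfl
    · rw [hk.laplaceKernel_zero (min_le_right _ _)] at lim
      have lim' : Tendsto (fun p => 1 - laplaceMartingale k q p y) L (𝓝 0) := by
        simpa using ENNReal.Tendsto.sub tendsto_const_nhds lim (Or.inl ENNReal.one_ne_top)
      have : 1 - laplaceMartingale k q q y = 0 := small _ fun j => by
        obtain ⟨a, ha, h⟩ := hy3 q j
        obtain ⟨p, hp1, hp2⟩ := ((lim'.eventually (gt_mem_nhds ha)).and hLq).exists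
        exact h p q hp2 hp1.le
      rw [self, tsub_eq_zero_iff_le] at this
      exact expNeg_eq_one_iff.1 (le_antisymm (expNeg_le_one _) this)
    · rw [hk.laplaceKernel_top (min_le_right _ _)] at lim
      have : laplaceMartingale k q q y = 0 := small _ fun j => by
        obtain ⟨a, ha, h⟩ := hy2 q j
        obtain ⟨p, hp1, hp2⟩ := ((lim.eventually (gt_mem_nhds ha)).and hLq).exists
        exact h p q hp2 hp1.le
      rw [self, ← expNeg_top] at this
      exact expNeg_strictAnti.injective this

end IsBranchingKernelFamily

/-! ### Right-continuous regularization -/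

/-- Rational approximation from the right. -/
noncomputable def ratApprox (n : ℕ) (t : ℝ≥0) : ℚ≥0 := ((⌊(n + 1) * t⌋₊ + 1 : ℕ) : ℚ≥0) / (n + 1)

lemma cast_ratApprox (n : ℕ) (t : ℝ≥0) :
    (ratApprox n t : ℝ≥0) = (⌊(n + 1) * t⌋₊ + 1) / (n + 1) := by
  simp [ratApprox]

lemma lt_ratApprox (n : ℕ) (t : ℝ≥0) : t < ratApprox n t := by
  rw [cast_ratApprox, lt_div_iff₀ (by positivity), mul_comm]
  exact Nat.lt_floor_add_one _

lemma ratApprox_le (n : ℕ) (t : ℝ≥0) : (ratApprox n t : ℝ≥0) ≤ t + 1 / (n + 1) := by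
  rw [cast_ratApprox, add_div]
  gcongr
  rw [div_le_iff₀ (by positivity), mul_comm]
  exact Nat.floor_le (by positivity)

lemma ratApprox_mono (n : ℕ) : Monotone (ratApprox n) := by
  intro s t hst
  unfold ratApprox
  gcongr

lemma tendsto_cast_ratApprox (t : ℝ≥0) :
    Tendsto (fun n => (ratApprox n t : ℝ≥0)) atTop (𝓝 t) := by
  have h : Tendsto (fun n : ℕ => t + 1 / ((n : ℝ≥0) + 1)) atTop (𝓝 (t + 0)) :=
    tendsto_const_nhds.add tendsto_one_div_add_atTop_nhds_zero_nat
  rw [add_zero] at h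
  exact tendsto_of_tendsto_of_tendsto_of_le_of_le tendsto_const_nhds h
    (fun n => (lt_ratApprox n t).le) (fun n => ratApprox_le n t)

lemma tendsto_ratApprox (t : ℝ≥0) : Tendsto (fun n => ratApprox n t) atTop (ratRight t) := by
  refine tendsto_comap_iff.2 (tendsto_nhdsWithin_iff.2 ⟨tendsto_cast_ratApprox t, ?_⟩)
  exact Eventually.of_forall fun n => lt_ratApprox n t

/-- The right limits of a function on the rationals. -/
noncomputable def rightPath (y : ℚ≥0 → ℝ≥0∞) (t : ℝ≥0) : ℝ≥0∞ :=
  limsup (fun n => y (ratApprox n t)) atTop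

lemma measurable_rightPath (t : ℝ≥0) : Measurable fun y => rightPath y t :=
  Measurable.limsup fun _ => measurable_pi_apply _

namespace IsRegularPath

variable {y : ℚ≥0 → ℝ≥0∞} (hy : IsRegularPath y)
include hy

lemma tendsto_rightPath (t : ℝ≥0) : Tendsto y (ratRight t) (𝓝 (rightPath y t)) := by
  obtain ⟨l, hl⟩ := hy.right t
  rwa [show rightPath y t = l from (hl.comp (tendsto_ratApprox t)).limsup_eq]

/-- With closed neighbourhoods for `V` this transfers one-sided limits from `y` to its right limits;
with a singleton it transfers absorption. -/
lemma rightPath_mem {V : Set ℝ≥0∞} (hV : IsClosed V) {c d : ℝ≥0}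
    (h : ∀ q : ℚ≥0, c < q → (q : ℝ≥0) < d → y q ∈ V) {s : ℝ≥0} (hcs : c ≤ s) (hsd : s < d) :
    rightPath y s ∈ V := by
  refine hV.mem_of_tendsto (hy.tendsto_rightPath s) ?_
  filter_upwards [(hasBasis_ratRight s).mem_of_mem hsd] with q hq
  exact h q (hcs.trans_lt hq.1) hq.2

lemma tendsto_nhdsGT (t : ℝ≥0) : Tendsto (rightPath y) (𝓝[>] t) (𝓝 (rightPath y t)) := by
  refine (closed_nhds_basis _).tendsto_right_iff.2 fun V hV => ?_
  obtain ⟨u, hu, hV'⟩ := (hasBasis_ratRight t).mem_iff.1 (hy.tendsto_rightPath t hV.1)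
  filter_upwards [Ioo_mem_nhdsGT hu] with s hs
  exact hy.rightPath_mem hV.2 (fun q h1 h2 => hV' ⟨h1, h2⟩) hs.1.le hs.2

lemma tendsto_nhdsLT {t : ℝ≥0} (ht : 0 < t) {l : ℝ≥0∞} (hl : Tendsto y (ratLeft t) (𝓝 l)) :
    Tendsto (rightPath y) (𝓝[<] t) (𝓝 l) := by
  refine (closed_nhds_basis _).tendsto_right_iff.2 fun V hV => ?_
  obtain ⟨u, hu, hV'⟩ := (hasBasis_ratLeft ht).mem_iff.1 (hl hV.1)
  filter_upwards [Ioo_mem_nhdsLT hu] with s hs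
  exact hy.rightPath_mem hV.2 (fun q h1 h2 => hV' ⟨h1, h2⟩) hs.1.le hs.2

lemma isCadlagPath : IsCadlagPath (rightPath y) := by
  intro t
  refine ⟨continuousWithinAt_Ioi_iff_Ici.1 (hy.tendsto_nhdsGT t), ?_⟩
  rcases eq_or_ne t 0 with rfl | ht
  · exact ⟨0, by simp⟩
  · obtain ⟨l, hl⟩ := hy.left t
    exact ⟨l, hy.tendsto_nhdsLT (pos_iff_ne_zero.2 ht) hl⟩

lemma eq_of_rightPath_eq {t : ℝ≥0} {r : ℝ≥0∞} (hr : r = 0 ∨ r = ∞) (h : rightPath y t = r)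
    {q : ℚ≥0} (hq : t < q) : y q = r := by
  refine hy.absorbed r hr (ratRight t) t q
    ((tendsto_cast_ratRight t).mono_right nhdsWithin_le_nhds) ?_ (h ▸ hy.tendsto_rightPath t)
  filter_upwards [(hasBasis_ratRight t).mem_of_mem hq] with p hp
  exact NNRat.cast_lt.1 hp.2

lemma isAbsorbedPath : IsAbsorbedPath (rightPath y) := by
  intro r hr t h u htu
  have key : ∀ q : ℚ≥0, t < q → y q = r := by
    intro q hq
    rcases h with h | ⟨ht, h⟩
    · exact hy.eq_of_rightPath_eq hr h hq
    · obtain ⟨l, hl⟩ := hy.left t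
      have hb : (𝓝[<] t).NeBot := nhdsLT_neBot_of_exists_lt ⟨0, ht⟩
      have := ratLeft_neBot ht
      obtain rfl := tendsto_nhds_unique (hy.tendsto_nhdsLT ht hl) h
      refine hy.absorbed l hr (ratLeft t) t q
        ((tendsto_cast_ratLeft t).mono_right nhdsWithin_le_nhds) ?_ hl
      filter_upwards [(tendsto_cast_ratLeft t).eventually self_mem_nhdsWithin] with p hp
      exact NNRat.cast_lt.1 (lt_trans hp hq)
  exact hy.rightPath_mem isClosed_singleton (fun q hq _ => key q hq) htu (lt_add_one u)

end IsRegularPath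

/-- The Markov property may be tested on products of continuous functions. -/
lemma isMarkovOn_of_continuous {T S Ω : Type*} [LinearOrder T] [MeasurableSpace S]
    [TopologicalSpace S] [BorelSpace S] [HasOuterApproxClosed S] [CompactSpace S]
    {κ : T → T → Kernel S S} (hκ : IsTransitionOn κ) {Y : T → Ω → S} {mΩ : MeasurableSpace Ω}
    {μ : Measure Ω} [IsProbabilityMeasure μ] (hY : ∀ t, Measurable (Y t))
    (h : ∀ a b, a ≤ b → ∀ K : Finset T, (∀ t ∈ K, t ≤ a) → ∀ g : T → C(S, ℝ≥0), ∀ f : C(S, ℝ≥0),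
      ∫⁻ ω, (∏ t ∈ K, (g t (Y t ω) : ℝ≥0∞)) * f (Y b ω) ∂μ =
        ∫⁻ ω, (∏ t ∈ K, (g t (Y t ω) : ℝ≥0∞)) * ∫⁻ y, f y ∂(κ a b (Y a ω)) ∂μ) :
    IsMarkovOn κ univ Y μ := by
  classical
  intro a _ b _ hab K hK g hg f hf
  have := hκ.markov a b hab
  have mK : Measurable fun ω (t : K) => Y t ω := measurable_pi_iff.2 fun t => hY t
  have m1 : Measurable fun ω => ((fun t : K => Y t ω), fun _ : Unit => Y b ω) :=
    mK.prodMk (measurable_pi_iff.2 fun _ => hY b)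
  have m2 : Measurable fun p : Ω × S => ((fun t : K => Y t p.1), fun _ : Unit => p.2) :=
    (mK.comp measurable_fst).prodMk (measurable_pi_iff.2 fun _ => measurable_snd)
  let η : Kernel Ω S := (κ a b).comap (Y a) (hY a)
  have I1 : ∀ F : (K → S) × (Unit → S) → ℝ≥0∞, Measurable F →
      ∫⁻ p, F p ∂(μ.map fun ω => ((fun t : K => Y t ω), fun _ : Unit => Y b ω)) =
        ∫⁻ ω, F ((fun t : K => Y t ω), fun _ : Unit => Y b ω) ∂μ := fun F hF =>
    lintegral_map hF m1
  have I2 : ∀ F : (K → S) × (Unit → S) → ℝ≥0∞, Measurable F →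
      ∫⁻ p, F p ∂((μ ⊗ₘ η).map fun p => ((fun t : K => Y t p.1), fun _ : Unit => p.2)) =
        ∫⁻ ω, ∫⁻ y, F ((fun t : K => Y t ω), fun _ : Unit => y) ∂(κ a b (Y a ω)) ∂μ := by
    intro F hF
    rw [lintegral_map hF m2, Measure.lintegral_compProd (f := fun p : Ω × S =>
      F ((fun t : K => Y t p.1), fun _ : Unit => p.2)) (hF.comp m2)]
    rfl
  -- The claim compares two joint laws: past and `Y b`, against past and a kernel sample from `Y a`.
  -- Products of bounded continuous functions separate them; the factor `Unit → S` merely casts the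
  -- last variable as a family.
  have key : (μ.map fun ω => ((fun t : K => Y t ω), fun _ : Unit => Y b ω)) =
      (μ ⊗ₘ η).map fun p => ((fun t : K => Y t p.1), fun _ : Unit => p.2) := by
    have : IsProbabilityMeasure
        (μ.map fun ω => ((fun t : K => Y t ω), fun _ : Unit => Y b ω)) :=
      Measure.isProbabilityMeasure_map m1.aemeasurable
    refine Measure.ext_of_lintegral_prod_mul_prod_boundedContinuousFunction fun φ ψ => ?_
    have mφ : Measurable fun p : (K → S) × (Unit → S) =>
        ((∏ i, φ i (p.1 i) : ℝ≥0) : ℝ≥0∞) * ((∏ j, ψ j (p.2 j) : ℝ≥0) : ℝ≥0∞) := by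
      fun_prop
    rw [I1 _ mφ, I2 _ mφ]
    have := h a b hab K (fun t ht => (hK t ht).2) (fun t => if ht : t ∈ K then (φ ⟨t, ht⟩).toContinuousMap else 1)
      (ψ ()).toContinuousMap
    have e : ∀ ω, ∏ t ∈ K, (((if ht : t ∈ K then (φ ⟨t, ht⟩).toContinuousMap else 1 : C(S, ℝ≥0))
        (Y t ω) : ℝ≥0) : ℝ≥0∞) = ((∏ i : K, φ i (Y i ω) : ℝ≥0) : ℝ≥0∞) := by
      intro ω
      rw [← Finset.prod_coe_sort, ENNReal.ofNNReal_finsetProd]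
      refine Finset.prod_congr rfl fun t _ => ?_
      simp
    simp_rw [e] at this
    simp only [Finset.univ_unique, Finset.prod_singleton]
    refine this.trans (lintegral_congr fun ω => ?_)
    rw [← lintegral_const_mul]
    · rfl
    · exact (ENNReal.continuous_coe.comp (ψ ()).continuous).measurable
  have mF : Measurable fun p : (K → S) × (Unit → S) => (∏ t : K, g t (p.1 t)) * f (p.2 ()) :=
    have m3 : ∀ t : K, Measurable fun p : (K → S) × (Unit → S) => g t (p.1 t) := fun t =>
      (hg t).comp (by fun_prop : Measurable fun p : (K → S) × (Unit → S) => p.1 t)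
    (Finset.measurable_fun_prod _ fun t _ => m3 t).mul
      (hf.comp (by fun_prop : Measurable fun p : (K → S) × (Unit → S) => p.2 ()))
  have e1 := I1 _ mF
  rw [key, I2 _ mF] at e1
  have hprod : ∀ ω, ∏ t ∈ K, g t (Y t ω) = ∏ t : K, g t (Y t ω) := fun ω =>
    (Finset.prod_coe_sort K fun t => g t (Y t ω)).symm
  simp_rw [hprod]
  rw [← e1]
  exact lintegral_congr fun ω => by simp only [lintegral_const_mul _ hf]

/-! ### Finite-dimensional distributions of the regularized process -/

lemma exists_forall_continuousMap_le {S : Type*} [TopologicalSpace S] [CompactSpace S]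
    (f : C(S, ℝ≥0)) : ∃ C : ℝ≥0, ∀ y, f y ≤ C := by
  obtain ⟨C, hC⟩ := (isCompact_range f.continuous).bddAbove
  exact ⟨C, fun y => hC (mem_range_self y)⟩

namespace IsBranchingKernelFamily

variable {k : ℝ≥0 → ℝ≥0 → Kernel ℝ≥0∞ ℝ≥0∞} (hk : IsBranchingKernelFamily k)
include hk

lemma isTransitionOn : IsTransitionOn k :=
  ⟨hk.markov, hk.diag, hk.chapman_kolmogorov⟩

/-- Weak continuity covers only finite starting points; `hx` handles `∞`, where the approximating
states must already be absorbed. -/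
lemma tendsto_lintegral_kernel (f : C(ℝ≥0∞, ℝ≥0)) {a b : ℝ≥0} {x : ℝ≥0∞} {u v : ℕ → ℝ≥0}
    {z : ℕ → ℝ≥0∞} (hab : a ≤ b) (huv : ∀ n, u n ≤ v n) (hu : Tendsto u atTop (𝓝 a))
    (hv : Tendsto v atTop (𝓝 b)) (hz : Tendsto z atTop (𝓝 x)) (hx : x = ∞ → ∀ n, z n = ∞) :
    Tendsto (fun n => ∫⁻ y, f y ∂(k (u n) (v n) (z n))) atTop (𝓝 (∫⁻ y, f y ∂(k a b x))) := by
  have mf : Measurable fun y => (f y : ℝ≥0∞) := (ENNReal.continuous_coe.comp f.continuous).measurable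
  induction x with
  | top =>
    refine tendsto_const_nhds.congr fun n => ?_
    rw [hx rfl n, hk.top a b hab, hk.top _ _ (huv n), lintegral_dirac' _ mf]
  | coe x =>
    have hz' := (ENNReal.tendsto_toNNReal ENNReal.coe_ne_top).comp hz
    have := ((hk.continuous_lintegral f).tendsto (a, b, x)).comp
      (hu.prodMk_nhds (hv.prodMk_nhds hz'))
    simp only [min_eq_left hab] at this
    refine this.congr' ?_
    filter_upwards [hz.eventually (gt_mem_nhds ENNReal.coe_lt_top)] with n hn
    simp only [Function.comp_apply, min_eq_left (huv n)]
    rw [ENNReal.coe_toNNReal hn.ne]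

/-- The regularization of a Markov process along the rationals is Markov. -/
theorem isMarkovOn_rightPath {μ : Measure (ℚ≥0 → ℝ≥0∞)} [IsProbabilityMeasure μ]
    (hμ : IsMarkovOn (fun p q : ℚ≥0 => k p q) univ (fun t ω => ω t) μ) :
    IsMarkovOn k univ (fun t y => rightPath y t) μ := by
  classical
  refine isMarkovOn_of_continuous hk.isTransitionOn measurable_rightPath ?_
  intro a b hab K hK g f
  have mf : Measurable fun y => (f y : ℝ≥0∞) := (ENNReal.continuous_coe.comp f.continuous).measurable
  have mg : ∀ t, Measurable fun y => (g t y : ℝ≥0∞) := fun t =>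
    (ENNReal.continuous_coe.comp (g t).continuous).measurable
  choose Cg hCg using fun t => exists_forall_continuousMap_le (g t)
  obtain ⟨Cf, hCf⟩ := exists_forall_continuousMap_le f
  have ev : ∀ q : ℚ≥0, Measurable fun y : ℚ≥0 → ℝ≥0∞ => y q := measurable_pi_apply
  have step : ∀ n, ∫⁻ y, (∏ t ∈ K, (g t (y (ratApprox n t)) : ℝ≥0∞)) * f (y (ratApprox n b)) ∂μ =
      ∫⁻ y, (∏ t ∈ K, (g t (y (ratApprox n t)) : ℝ≥0∞)) *
        ∫⁻ z, f z ∂(k (ratApprox n a) (ratApprox n b) (y (ratApprox n a))) ∂μ := by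
    intro n
    have := hμ (ratApprox n a) (mem_univ _) (ratApprox n b) (mem_univ _) (ratApprox_mono n hab)
      (K.image (ratApprox n)) (by
        intro q hq
        obtain ⟨t, ht, rfl⟩ := Finset.mem_image.1 hq
        exact ⟨mem_univ _, ratApprox_mono n (hK t ht)⟩)
      -- Several times of `K` may have the same rational approximation, so their factors are
      -- grouped.
      (fun q z => ∏ t ∈ K with ratApprox n t = q, (g t z : ℝ≥0∞))
      (fun q => Finset.measurable_fun_prod _ fun t _ => mg t) _ mf
    have e : ∀ y : ℚ≥0 → ℝ≥0∞, ∏ q ∈ K.image (ratApprox n),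
        ∏ t ∈ K with ratApprox n t = q, (g t (y q) : ℝ≥0∞) =
          ∏ t ∈ K, (g t (y (ratApprox n t)) : ℝ≥0∞) := fun y =>
      Finset.prod_image' _ fun t ht => Finset.prod_congr rfl fun t' ht' => by
        rw [(Finset.mem_filter.1 ht').2]
    simpa only [e] using this
  have reg := hk.ae_isRegularPath hμ
  have lim : ∀ {y : ℚ≥0 → ℝ≥0∞}, IsRegularPath y → ∀ t,
      Tendsto (fun n => y (ratApprox n t)) atTop (𝓝 (rightPath y t)) := fun hy t =>
    (hy.tendsto_rightPath t).comp (tendsto_ratApprox t)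
  have limg : ∀ {y : ℚ≥0 → ℝ≥0∞}, IsRegularPath y →
      Tendsto (fun n => ∏ t ∈ K, (g t (y (ratApprox n t)) : ℝ≥0∞)) atTop
        (𝓝 (∏ t ∈ K, (g t (rightPath y t) : ℝ≥0∞))) := by
    intro y hy
    simp_rw [← ENNReal.ofNNReal_finsetProd]
    exact ENNReal.tendsto_coe.2 (tendsto_finsetProd _ fun t _ =>
      ((g t).continuous.tendsto _).comp (lim hy t))
  have fing : ∀ y : ℝ≥0 → ℝ≥0∞, ∏ t ∈ K, (g t (y t) : ℝ≥0∞) ≠ ∞ := fun y => by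
    rw [← ENNReal.ofNNReal_finsetProd]
    exact ENNReal.coe_ne_top
  have bdg : ∀ y : ℝ≥0 → ℝ≥0∞, ∏ t ∈ K, (g t (y t) : ℝ≥0∞) ≤ ∏ t ∈ K, (Cg t : ℝ≥0∞) := fun y =>
    Finset.prod_le_prod' fun t _ => ENNReal.coe_le_coe.2 (hCg t _)
  have bdk : ∀ {s t : ℝ≥0}, s ≤ t → ∀ x, ∫⁻ z, f z ∂(k s t x) ≤ Cf := by
    intro s t hst x
    have := hk.markov s t hst
    exact (lintegral_mono fun z => ENNReal.coe_le_coe.2 (hCf z)).trans (by simp)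
  have finB : ∫⁻ _, (∏ t ∈ K, (Cg t : ℝ≥0∞)) * Cf ∂μ ≠ ∞ := by
    rw [← ENNReal.ofNNReal_finsetProd, lintegral_const, measure_univ, mul_one]
    exact ENNReal.mul_ne_top ENNReal.coe_ne_top ENNReal.coe_ne_top
  have mprod : ∀ n, Measurable fun y : ℚ≥0 → ℝ≥0∞ => ∏ t ∈ K, (g t (y (ratApprox n t)) : ℝ≥0∞) :=
    fun n => Finset.measurable_fun_prod _ fun t _ => (mg t).comp (ev _)
  have hle : ∀ n, (ratApprox n a : ℝ≥0) ≤ ratApprox n b := fun n =>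
    NNRat.cast_le.2 (ratApprox_mono n hab)
  have L1 := tendsto_lintegral_of_dominated_convergence (μ := μ)
    (F := fun n (y : ℚ≥0 → ℝ≥0∞) =>
      (∏ t ∈ K, (g t (y (ratApprox n t)) : ℝ≥0∞)) * f (y (ratApprox n b)))
    (f := fun y => (∏ t ∈ K, (g t (rightPath y t) : ℝ≥0∞)) * f (rightPath y b))
    (fun _ => (∏ t ∈ K, (Cg t : ℝ≥0∞)) * Cf) (fun n => (mprod n).mul (mf.comp (ev _)))
    (fun n => ae_of_all _ fun y => mul_le_mul' (bdg fun t => y (ratApprox n t))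
      (ENNReal.coe_le_coe.2 (hCf _))) finB (by
        filter_upwards [reg] with y hy
        refine ENNReal.Tendsto.mul (limg hy) (Or.inr ENNReal.coe_ne_top)
          (ENNReal.tendsto_coe.2 ((f.continuous.tendsto _).comp (lim hy b)))
          (Or.inr (fing _)))
  have L2 := tendsto_lintegral_of_dominated_convergence (μ := μ)
    (F := fun n (y : ℚ≥0 → ℝ≥0∞) => (∏ t ∈ K, (g t (y (ratApprox n t)) : ℝ≥0∞)) *
      ∫⁻ z, f z ∂(k (ratApprox n a) (ratApprox n b) (y (ratApprox n a))))
    (f := fun y => (∏ t ∈ K, (g t (rightPath y t) : ℝ≥0∞)) * ∫⁻ z, f z ∂(k a b (rightPath y a)))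
    (fun _ => (∏ t ∈ K, (Cg t : ℝ≥0∞)) * Cf)
    (fun n => (mprod n).mul (mf.lintegral_kernel.comp (ev _)))
    (fun n => ae_of_all _ fun y => mul_le_mul' (bdg fun t => y (ratApprox n t))
      (bdk (hle n) _)) finB (by
        filter_upwards [reg] with y hy
        refine ENNReal.Tendsto.mul (limg hy)
          (Or.inr ((bdk hab _).trans_lt ENNReal.coe_lt_top).ne) ?_ (Or.inr (fing _))
        exact hk.tendsto_lintegral_kernel f hab hle (tendsto_cast_ratApprox a)
          (tendsto_cast_ratApprox b) (lim hy a)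
          -- If the right limit at `a` is `∞`, absorption makes the path infinite at every later
          -- rational, in particular at all approximations, which lie strictly to the right of `a`.
          fun h n => hy.eq_of_rightPath_eq (Or.inr rfl) h (lt_ratApprox n a))
  simp_rw [step] at L1
  exact tendsto_nhds_unique L1 L2

/-- The regularized process has the right initial value. -/
theorem ae_rightPath_zero {μ : Measure (ℚ≥0 → ℝ≥0∞)} [IsProbabilityMeasure μ]
    (hμ : IsMarkovOn (fun p q : ℚ≥0 => k p q) univ (fun t ω => ω t) μ) {x : ℝ≥0∞}
    (hx : ∀ᵐ ω ∂μ, ω ⊥ = x) : ∀ᵐ y ∂μ, rightPath y 0 = x := by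
  have reg := hk.ae_isRegularPath hμ
  have m0 := measurable_rightPath 0
  have := Measure.isProbabilityMeasure_map (μ := μ) m0.aemeasurable
  -- The law of `rightPath y 0` is the weak limit of the kernels from 0 to `q` started in `x` as `q`
  -- decreases to 0.
  have law : μ.map (fun y => rightPath y 0) = Measure.dirac x := by
    refine ext_of_forall_lintegral_eq_of_IsFiniteMeasure fun f => ?_
    have mf : Measurable fun y => (f y : ℝ≥0∞) :=
      (ENNReal.continuous_coe.comp f.continuous).measurable
    obtain ⟨C, hC⟩ := exists_forall_continuousMap_le f.toContinuousMap
    rw [lintegral_map mf m0, lintegral_dirac' _ mf]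
    have L1 := tendsto_lintegral_of_dominated_convergence (μ := μ)
      (F := fun n (y : ℚ≥0 → ℝ≥0∞) => (f (y (ratApprox n 0)) : ℝ≥0∞))
      (f := fun y => (f (rightPath y 0) : ℝ≥0∞)) (fun _ => C)
      (fun n => mf.comp (measurable_pi_apply _))
      (fun n => ae_of_all _ fun y => ENNReal.coe_le_coe.2 (hC _)) (by simp) (by
        filter_upwards [reg] with y hy
        exact ENNReal.tendsto_coe.2 ((f.continuous.tendsto _).comp
          ((hy.tendsto_rightPath 0).comp (tendsto_ratApprox 0))))
    have e : ∀ n, ∫⁻ y, (f (y (ratApprox n 0)) : ℝ≥0∞) ∂μ =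
        ∫⁻ z, f z ∂(k (0 : ℝ≥0) (ratApprox n 0) x) := fun n => by
      rw [hμ.lintegral_eq_of_initial (mem_univ ⊥) (mem_univ _) bot_le hx mf]
      simp
    simp_rw [e] at L1
    have L2 := hk.tendsto_lintegral_kernel f.toContinuousMap (a := 0) (b := 0) (x := x)
      (u := fun _ => 0) (v := fun n => ratApprox n 0) (z := fun _ => x) le_rfl (fun _ => zero_le)
      tendsto_const_nhds (tendsto_cast_ratApprox 0) tendsto_const_nhds (fun h _ => h)
    rw [hk.diag] at L2
    exact (tendsto_nhds_unique L1 L2).trans (lintegral_dirac' x mf)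
  have : ∀ᵐ z ∂(μ.map fun y => rightPath y 0), z = x := by
    rw [law]
    exact (ae_dirac_iff (p := fun z => z = x) (measurableSet_singleton x)).2 rfl
  exact ae_of_ae_map m0.aemeasurable this

end IsBranchingKernelFamily

/-! ### Path-space measures -/

lemma lintegral_mul_eq_of_setLIntegral_eq {Ω : Type*} {m mΩ : MeasurableSpace Ω} {μ : Measure Ω}
    (hm : m ≤ mΩ) {u v : Ω → ℝ≥0∞} (hu : Measurable u) (hv : Measurable v)
    (h : ∀ A, MeasurableSet[m] A → ∫⁻ ω in A, u ω ∂μ = ∫⁻ ω in A, v ω ∂μ)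
    {G : Ω → ℝ≥0∞} (hG : Measurable[m] G) :
    ∫⁻ ω, G ω * u ω ∂μ = ∫⁻ ω, G ω * v ω ∂μ := by
  have key : (μ.withDensity u).trim hm = (μ.withDensity v).trim hm := by
    refine @Measure.ext _ m _ _ fun A hA => ?_
    rw [trim_measurableSet_eq hm hA, trim_measurableSet_eq hm hA, withDensity_apply _ (hm A hA),
      withDensity_apply _ (hm A hA), h A hA]
  have hG' : Measurable G := hG.mono hm le_rfl
  have := congrArg (fun ν : @Measure Ω m => @lintegral Ω m ν G) key
  simp only [lintegral_trim hm hG] at this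
  rw [lintegral_withDensity_eq_lintegral_mul _ hu hG',
    lintegral_withDensity_eq_lintegral_mul _ hv hG'] at this
  simpa only [Pi.mul_apply, mul_comm] using this

section Bridge

variable {T S : Type*} [LinearOrder T] [MeasurableSpace S] {κ : T → T → Kernel S S}

/-- The product form of the Markov property implies the conditional form. -/
lemma IsMarkovOn.condExp_ae_eq {Ω : Type*} {m mΩ : MeasurableSpace Ω} {μ : Measure Ω}
    [IsProbabilityMeasure μ] {J : Set T} {Z : T → Ω → S} (h : IsMarkovOn κ J Z μ)
    (hκ : IsTransitionOn κ) (hZ : ∀ t ∈ J, Measurable (Z t)) {a b : T} (ha : a ∈ J) (hb : b ∈ J)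
    (hab : a ≤ b) (hm : m = ⨆ t ∈ J ∩ Iic a, MeasurableSpace.comap (Z t) inferInstance)
    {f : S → ℝ} (hf : Measurable f) {C : ℝ} (hC : ∀ y, |f y| ≤ C) :
    μ[fun ω => f (Z b ω) | m] =ᵐ[μ] fun ω => ∫ y, f y ∂(κ a b (Z a ω)) := by
  have := hκ.markov a b hab
  have hmle : m ≤ mΩ := hm.trans_le <| iSup₂_le fun t ht => (hZ t ht.1).comap_le
  have hZa : Measurable[m] (Z a) := by
    rw [hm]
    exact measurable_iff_comap_le.2 (le_iSup₂_of_le a ⟨ha, self_mem_Iic⟩ le_rfl)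
  have hC0 : ∀ y, 0 ≤ f y + C := fun y => by linarith [neg_abs_le (f y), hC y]
  have hfκ : ∀ x, Integrable f (κ a b x) := fun x =>
    Integrable.of_bound hf.aestronglyMeasurable C (ae_of_all _ hC)
  have hfZ : Integrable (fun ω => f (Z b ω)) μ :=
    Integrable.of_bound (hf.comp (hZ b hb)).aestronglyMeasurable C (ae_of_all _ fun ω => hC _)
  -- Adding `C` makes the bounded function nonnegative, so the `ℝ≥0∞`-valued identity applies; the
  -- constant is subtracted again in `e1` and `e2`.
  set φ : S → ℝ≥0∞ := fun y => ENNReal.ofReal (f y + C) with hφ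
  have mφ : Measurable φ := (hf.add_const C).ennreal_ofReal
  have bφ : ∀ y, φ y ≤ ((2 * C).toNNReal : ℝ≥0) := fun y =>
    ENNReal.ofReal_le_ofReal (by linarith [le_abs_self (f y), hC y])
  have bκφ : ∀ x, ∫⁻ y, φ y ∂(κ a b x) ≤ ((2 * C).toNNReal : ℝ≥0) := fun x =>
    (lintegral_mono bφ).trans (by simp)
  have eκ : ∀ x, ∫ y, f y ∂(κ a b x) = (∫⁻ y, φ y ∂(κ a b x)).toReal - C := by
    intro x
    rw [← integral_eq_lintegral_of_nonneg_ae (ae_of_all _ hC0)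
      (hf.add_const C).aestronglyMeasurable, integral_add (hfκ x) (integrable_const _)]
    simp
  have mκ : Measurable fun x => ∫ y, f y ∂(κ a b x) := by
    simp_rw [eκ]
    exact mφ.lintegral_kernel.ennreal_toReal.sub_const C
  have bκ : ∀ x, ‖∫ y, f y ∂(κ a b x)‖ ≤ C := fun x => by
    refine (norm_integral_le_of_norm_le_const (ae_of_all _ hC)).trans ?_
    simp
  have mκZ : Measurable[m] fun ω => ∫ y, f y ∂(κ a b (Z a ω)) := mκ.comp hZa
  have iκZ : Integrable (fun ω => ∫ y, f y ∂(κ a b (Z a ω))) μ :=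
    Integrable.of_bound (mκZ.mono hmle le_rfl).aestronglyMeasurable C (ae_of_all _ fun ω => bκ _)
  symm
  refine ae_eq_condExp_of_forall_setIntegral_eq hmle hfZ (fun A _ _ => iκZ.integrableOn) ?_
    mκZ.stronglyMeasurable.aestronglyMeasurable
  intro A hA _
  have hA' := hmle A hA
  have key := h.lintegral_mul hκ hZ ha hb hab hm
    (G := A.indicator 1) (measurable_indicator_one_of hA) mφ bφ
  have e : ∀ ψ : Ω → ℝ≥0∞, ∫⁻ ω, A.indicator (1 : Ω → ℝ≥0∞) ω * ψ ω ∂μ = ∫⁻ ω in A, ψ ω ∂μ := by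
    intro ψ
    rw [← lintegral_indicator hA']
    congr 1 with ω
    by_cases h : ω ∈ A <;> simp [h]
  rw [e, e] at key
  have e1 : ∫ ω in A, f (Z b ω) ∂μ = (∫⁻ ω in A, φ (Z b ω) ∂μ).toReal - μ.real A * C := by
    rw [← integral_eq_lintegral_of_nonneg_ae (ae_of_all _ fun ω => hC0 _)
      ((hf.add_const C).comp (hZ b hb)).aestronglyMeasurable,
      integral_add hfZ.integrableOn (integrable_const _)]
    simp
  have e2 : ∫ ω in A, ∫ y, f y ∂(κ a b (Z a ω)) ∂μ =
      (∫⁻ ω in A, ∫⁻ y, φ y ∂(κ a b (Z a ω)) ∂μ).toReal - μ.real A * C := by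
    have mk : Measurable fun ω => ∫⁻ y, φ y ∂(κ a b (Z a ω)) := mφ.lintegral_kernel.comp (hZ a ha)
    rw [← integral_toReal mk.aemeasurable
      (ae_of_all _ fun ω => (bκφ _).trans_lt ENNReal.coe_lt_top)]
    simp_rw [eκ]
    rw [integral_sub _ (integrable_const _)]
    · simp
    · refine Integrable.of_bound mk.ennreal_toReal.aestronglyMeasurable
        ((2 * C).toNNReal : ℝ) (ae_of_all _ fun ω => ?_)
      rw [Real.norm_of_nonneg ENNReal.toReal_nonneg]
      exact ENNReal.toReal_mono ENNReal.coe_ne_top (bκφ _)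
  rw [e1, e2, key]

/-- Tested on indicators, the hypothesis says that, restricted to `A`, the law of `W` equals the
mixture of the kernel `η`. Equality of measures then covers unbounded nonnegative `f`. -/
lemma setLIntegral_eq_of_condExp {Ω S : Type*} [MeasurableSpace S] {m mΩ : MeasurableSpace Ω}
    {μ : Measure Ω} [IsProbabilityMeasure μ] (hmle : m ≤ mΩ) (η : Kernel Ω S) [IsMarkovKernel η]
    {W : Ω → S} (hW : Measurable W)
    (h : ∀ f : S → ℝ, Measurable f → (∃ C : ℝ, ∀ y, |f y| ≤ C) →
      μ[fun ω => f (W ω) | m] =ᵐ[μ] fun ω => ∫ y, f y ∂(η ω))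
    {f : S → ℝ≥0∞} (hf : Measurable f) {A : Set Ω} (hA : MeasurableSet[m] A) :
    ∫⁻ ω in A, f (W ω) ∂μ = ∫⁻ ω in A, ∫⁻ y, f y ∂(η ω) ∂μ := by
  have hA' := hmle A hA
  have key : (μ.restrict A).map W = (μ.restrict A).bind η := by
    refine Measure.ext fun B hB => ?_
    rw [Measure.map_apply hW hB, Measure.bind_apply hB η.aemeasurable]
    have mB : Measurable (B.indicator (1 : S → ℝ)) := measurable_one.indicator hB
    have bB : ∀ y, |B.indicator (1 : S → ℝ) y| ≤ 1 := fun y => by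
      by_cases hy : y ∈ B <;> simp [hy]
    have iB : Integrable (fun ω => B.indicator (1 : S → ℝ) (W ω)) μ :=
      Integrable.of_bound (mB.comp hW).aestronglyMeasurable 1 (ae_of_all _ fun ω => bB _)
    have e := setIntegral_condExp hmle iB hA
    rw [setIntegral_congr_ae hA' ((h _ mB ⟨1, bB⟩).mono fun ω hω _ => hω)] at e
    have e1 : ∫ ω in A, B.indicator (1 : S → ℝ) (W ω) ∂μ =
        ((μ.restrict A) (W ⁻¹' B)).toReal := by
      have : (fun ω => B.indicator (1 : S → ℝ) (W ω)) = (W ⁻¹' B).indicator 1 := rfl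
      rw [this, integral_indicator_one (hW hB)]
      rfl
    have e2 : ∫ ω in A, ∫ y, B.indicator (1 : S → ℝ) y ∂(η ω) ∂μ =
        (∫⁻ ω in A, η ω B ∂μ).toReal := by
      rw [← integral_toReal (η.measurable_coe hB).aemeasurable
        (ae_of_all _ fun ω => measure_lt_top _ _)]
      exact integral_congr_ae (ae_of_all _ fun ω => integral_indicator_one hB)
    rw [e1, e2] at e
    refine ((ENNReal.toReal_eq_toReal_iff' ?_ (measure_ne_top _ _)).1 e).symm
    have : ∫⁻ ω in A, η ω B ∂μ ≤ ∫⁻ ω in A, 1 ∂μ := lintegral_mono fun ω => prob_le_one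
    exact (this.trans_lt (by simp)).ne
  have := congrArg (fun ν => ∫⁻ y, f y ∂ν) key
  rwa [lintegral_map hf hW, Measure.lintegral_bind η.aemeasurable hf.aemeasurable] at this

/-- The conditional form of the Markov property implies the product form. -/
lemma isMarkovOn_of_condExp {Ω : Type*} {mΩ : MeasurableSpace Ω} {μ : Measure Ω}
    [IsProbabilityMeasure μ] {J : Set T} {Z : T → Ω → S}
    (hκ : IsTransitionOn κ) (hZ : ∀ t ∈ J, Measurable (Z t))
    (h : ∀ a ∈ J, ∀ b ∈ J, a ≤ b → ∀ f : S → ℝ, Measurable f → (∃ C : ℝ, ∀ y, |f y| ≤ C) →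
      μ[fun ω => f (Z b ω) | ⨆ t ∈ J ∩ Iic a, MeasurableSpace.comap (Z t) inferInstance] =ᵐ[μ]
        fun ω => ∫ y, f y ∂(κ a b (Z a ω))) :
    IsMarkovOn κ J Z μ := by
  intro a ha b hb hab K hK g hg f hf
  have := hκ.markov a b hab
  specialize h a ha b hb hab
  have hmle : (⨆ t ∈ J ∩ Iic a, MeasurableSpace.comap (Z t) inferInstance) ≤ mΩ :=
    iSup₂_le fun t ht => (hZ t ht.1).comap_le
  have hG : Measurable[⨆ t ∈ J ∩ Iic a, MeasurableSpace.comap (Z t) inferInstance]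
      fun ω => ∏ t ∈ K, g t (Z t ω) := by
    refine Finset.measurable_fun_prod _ fun t ht => (hg t).comp ?_
    exact measurable_iff_comap_le.2 (le_iSup₂_of_le t (hK t ht) le_rfl)
  generalize (⨆ t ∈ J ∩ Iic a, MeasurableSpace.comap (Z t) inferInstance) = m at h hmle hG
  refine lintegral_mul_eq_of_setLIntegral_eq hmle (hf.comp (hZ b hb))
    (hf.lintegral_kernel.comp (hZ a ha)) (fun A hA => ?_) hG
  exact setLIntegral_eq_of_condExp hmle ((κ a b).comap (Z a) (hZ a ha)) (hZ b hb) h hf hA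

/-- Transport of the product form of the Markov property to an image measure. -/
lemma IsMarkovOn.map {Ω Ω' : Type*} {mΩ : MeasurableSpace Ω} {mΩ' : MeasurableSpace Ω'}
    {μ : Measure Ω} {J : Set T} {Y : T → Ω → S} {Z : T → Ω' → S} (h : IsMarkovOn κ J Y μ)
    {Φ : Ω → Ω'} (hΦ : Measurable Φ) (hZ : ∀ t ∈ J, Measurable (Z t))
    (hYZ : ∀ᵐ ω ∂μ, ∀ t, Z t (Φ ω) = Y t ω) : IsMarkovOn κ J Z (μ.map Φ) := by
  intro a ha b hb hab K hK g hg f hf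
  have mK : Measurable fun ω => ∏ t ∈ K, g t (Z t ω) :=
    Finset.measurable_fun_prod _ fun t ht => (hg t).comp (hZ t (hK t ht).1)
  have m1 : Measurable fun ω => (∏ t ∈ K, g t (Z t ω)) * f (Z b ω) := mK.mul (hf.comp (hZ b hb))
  have m2 : Measurable fun ω => (∏ t ∈ K, g t (Z t ω)) * ∫⁻ y, f y ∂(κ a b (Z a ω)) :=
    mK.mul (hf.lintegral_kernel.comp (hZ a ha))
  rw [lintegral_map m1 hΦ, lintegral_map m2 hΦ]
  refine Eq.trans (lintegral_congr_ae ?_) ((h a ha b hb hab K hK g hg f hf).trans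
    (lintegral_congr_ae ?_))
  · filter_upwards [hYZ] with ω hω
    simp only [hω]
  · filter_upwards [hYZ] with ω hω
    simp only [hω]

/-- A measure on the σ-field generated by a process is determined by integrals of products. -/
lemma ext_of_lintegral_prod_eq {Ω : Type*} {mΩ : MeasurableSpace Ω} {J : Set T} {Z : T → Ω → S}
    (hm : mΩ = ⨆ t ∈ J, MeasurableSpace.comap (Z t) inferInstance) {μ μ' : Measure Ω}
    [IsFiniteMeasure μ]
    (h : ∀ K : Finset T, (∀ t ∈ K, t ∈ J) → ∀ g : T → S → ℝ≥0∞, (∀ t, Measurable (g t)) →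
      ∫⁻ ω, ∏ t ∈ K, g t (Z t ω) ∂μ = ∫⁻ ω, ∏ t ∈ K, g t (Z t ω) ∂μ') : μ = μ' := by
  classical
  have hZ : ∀ t ∈ J, Measurable (Z t) := fun t ht => by
    rw [hm]
    exact measurable_iff_comap_le.2 (le_iSup₂_of_le t ht le_rfl)
  refine ext_of_generate_finite _
    (hm.trans (generateFrom_piiUnionInter_measurableSet _ J).symm)
    (isPiSystem_piiUnionInter _ (fun t =>
      @MeasurableSpace.isPiSystem_measurableSet _ (MeasurableSpace.comap (Z t) inferInstance))
      _) ?_ ?_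
  · rintro s ⟨K, hK, A, hA, rfl⟩
    choose! B hB hBA using hA
    have hms : MeasurableSet (⋂ t ∈ K, A t) := Finset.measurableSet_biInter _ fun t ht => by
      rw [← hBA t ht]; exact hZ t (hK ht) (hB t ht)
    rw [← lintegral_indicator_one hms, ← lintegral_indicator_one hms]
    let g : T → S → ℝ≥0∞ := fun t => if t ∈ K then (B t).indicator 1 else 1
    have hg : ∀ t, Measurable (g t) := by
      intro t
      by_cases ht : t ∈ K
      · simpa [g, ht] using measurable_one.indicator (hB t ht)
      · simpa [g, ht] using (measurable_one : Measurable (1 : S → ℝ≥0∞))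
    have e : ∀ ω, ∏ t ∈ K, g t (Z t ω) = (⋂ t ∈ K, A t).indicator 1 ω := by
      intro ω
      have : ∀ t ∈ K, g t (Z t ω) = if ω ∈ A t then 1 else 0 := by
        intro t ht
        simp [g, ht, Set.indicator_apply, ← hBA t ht]
      rw [Finset.prod_congr rfl this, Finset.prod_ite_zero]
      simp [Set.indicator_apply]
    simpa only [e] using h K (fun t ht => hK ht) g hg
  · simpa using h ∅ (by simp) (fun _ _ => 1) (fun _ => measurable_const)

end Bridge

/-! ### The branching process on path space -/

namespace IsBranchingKernelFamily

variable {k : ℝ≥0 → ℝ≥0 → Kernel ℝ≥0∞ ℝ≥0∞} (hk : IsBranchingKernelFamily k)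
include hk

/-- The kernels frozen before time `s`. -/
lemma freeze (s : ℝ≥0) : IsBranchingKernelFamily fun a b => k (max s a) (max s b) where
  markov a b hab := hk.markov _ _ (max_le_max_left s hab)
  diag a x := hk.diag _ x
  chapman_kolmogorov a b c hab hbc :=
    hk.chapman_kolmogorov _ _ _ (max_le_max_left s hab) (max_le_max_left s hbc)
  weak_continuous := by
    have : Continuous fun p : {q : ℝ≥0 × ℝ≥0 // q.1 ≤ q.2} × ℝ≥0 =>
        ((⟨(max s p.1.1.1, max s p.1.1.2), max_le_max_left s p.1.2⟩, p.2) :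
          {q : ℝ≥0 × ℝ≥0 // q.1 ≤ q.2} × ℝ≥0) := by fun_prop
    exact hk.weak_continuous.comp this
  branching a b hab := hk.branching _ _ (max_le_max_left s hab)
  zero a b hab := hk.zero _ _ (max_le_max_left s hab)
  top a b hab := hk.top _ _ (max_le_max_left s hab)

end IsBranchingKernelFamily

/-- The path which is constantly `0`. -/
def zeroPath : BranchingPathSpace :=
  ⟨fun _ => 0, fun _ => ⟨continuousWithinAt_const, 0, tendsto_const_nhds⟩, by
    rintro r hr t (h | ⟨ht, h⟩) u -
    · exact h
    · have : (𝓝[<] t).NeBot := nhdsLT_neBot_of_exists_lt ⟨0, ht⟩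
      exact tendsto_nhds_unique tendsto_const_nhds h⟩

open Classical in
/-- The regularized path, for paths in a set of regular paths. -/
noncomputable def toPathSpace (G : Set (ℚ≥0 → ℝ≥0∞)) (hG : ∀ y ∈ G, IsRegularPath y)
    (y : ℚ≥0 → ℝ≥0∞) : BranchingPathSpace :=
  if h : y ∈ G then ⟨rightPath y, (hG y h).isCadlagPath, (hG y h).isAbsorbedPath⟩ else zeroPath

lemma coordProcess_toPathSpace {G : Set (ℚ≥0 → ℝ≥0∞)} (hG : ∀ y ∈ G, IsRegularPath y)
    {y : ℚ≥0 → ℝ≥0∞} (hy : y ∈ G) (t : ℝ≥0) :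
    coordProcess t (toPathSpace G hG y) = rightPath y t := by
  simp [toPathSpace, hy, coordProcess]

lemma measurable_toPathSpace {G : Set (ℚ≥0 → ℝ≥0∞)} (hG : ∀ y ∈ G, IsRegularPath y)
    (hGm : MeasurableSet G) (I : Set ℝ≥0) : Measurable[_, coordSigma I] (toPathSpace G hG) := by
  classical
  rw [measurable_iff_comap_le, coordSigma]
  simp_rw [MeasurableSpace.comap_iSup, MeasurableSpace.comap_comp]
  refine iSup₂_le fun t _ => measurable_iff_comap_le.1 ?_
  have : coordProcess t ∘ toPathSpace G hG = fun y => if y ∈ G then rightPath y t else 0 := by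
    ext y
    by_cases hy : y ∈ G
    · simp [hy, coordProcess_toPathSpace hG hy]
    · simp [toPathSpace, hy, coordProcess, zeroPath]
  rw [this]
  exact Measurable.ite hGm (measurable_rightPath t) measurable_const

lemma measurable_coordProcess {I : Set ℝ≥0} {t : ℝ≥0} (ht : t ∈ I) :
    Measurable[coordSigma I] (coordProcess t) :=
  measurable_iff_comap_le.2 (le_iSup₂_of_le t ht le_rfl)

lemma measurableSet_initial {s : ℝ≥0} {mΩ : MeasurableSpace BranchingPathSpace}
    (hm : mΩ = coordSigma (Ici s)) (x : ℝ≥0∞) : MeasurableSet {ω | coordProcess s ω = x} := by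
  rw [hm]
  exact measurable_coordProcess (I := Ici s) self_mem_Ici (measurableSet_singleton x)

lemma coordSigma_mono {I J : Set ℝ≥0} (h : I ⊆ J) : coordSigma I ≤ coordSigma J :=
  biSup_mono fun _ ht => h ht

namespace IsBranchingKernelFamily

variable {k : ℝ≥0 → ℝ≥0 → Kernel ℝ≥0∞ ℝ≥0∞} (hk : IsBranchingKernelFamily k)
include hk

/-- Existence of the law on path space of the process started at time `s` in `x`. -/
theorem exists_pathLaw (s : ℝ≥0) (x : ℝ≥0∞) :
    ∃ P : @Measure BranchingPathSpace (coordSigma (Ici s)),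
      @IsProbabilityMeasure _ (coordSigma (Ici s)) P ∧
      (∀ᵐ ω ∂P, coordProcess s ω = x) ∧
      @IsMarkovOn _ _ _ _ _ k (Ici s) coordProcess (coordSigma (Ici s)) P := by
  -- With frozen kernels the process started at time 0 rests at `x` until `s` and follows `k`
  -- afterwards.
  have hk' := hk.freeze s
  obtain ⟨μ, hμp, hμ0, hμ⟩ := exists_measure_isMarkovOn hk'.isTransitionOn_rat x
  have reg := hk'.ae_isRegularPath hμ
  -- The set of regular paths is not known to be measurable; a measurable subset of full measure
  -- makes the map to path space measurable.
  obtain ⟨G, hGm, hGsub, hGae⟩ : ∃ G : Set (ℚ≥0 → ℝ≥0∞), MeasurableSet G ∧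
      (∀ y ∈ G, IsRegularPath y) ∧ ∀ᵐ y ∂μ, y ∈ G := by
    obtain ⟨G, hGsub, hGm, hG⟩ := exists_measurable_superset_of_null (ae_iff.1 reg)
    refine ⟨Gᶜ, hGm.compl, fun y hy => ?_, ?_⟩
    · by_contra h
      exact hy (hGsub h)
    · rw [ae_iff]
      simpa using hG
  have mΦ := measurable_toPathSpace hGsub hGm (Ici s)
  have hM := hk'.isMarkovOn_rightPath hμ
  have h0 := hk'.ae_rightPath_zero hμ hμ0
  have hs : ∀ᵐ y ∂μ, rightPath y s = x := by
    have mx : MeasurableSet ({x}ᶜ : Set ℝ≥0∞) := (measurableSet_singleton x).compl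
    have := hM.lintegral_eq_of_initial (mem_univ 0) (mem_univ s) zero_le h0
      (measurable_indicator_one_of mx)
    rw [max_self, max_eq_left zero_le, hk.diag, lintegral_dirac' _ (measurable_indicator_one_of mx)]
      at this
    have e := (lintegral_eq_zero_iff ((measurable_indicator_one_of mx).comp
      (measurable_rightPath s))).1 (this.trans (by simp))
    filter_upwards [e] with y hy
    by_contra h
    simp [h] at hy
  have hae : ∀ᵐ y ∂μ, ∀ t, coordProcess t (toPathSpace G hGsub y) = rightPath y t := by
    filter_upwards [hGae] with y hy t using coordProcess_toPathSpace hGsub hy t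
  have hM' : IsMarkovOn k (Ici s) (fun t y => rightPath y t) μ := by
    intro a ha b hb hab K hK g hg f hf
    have := hM a (mem_univ a) b (mem_univ b) hab K (fun t ht => ⟨mem_univ t, (hK t ht).2⟩) g hg f hf
    simpa only [max_eq_right (mem_Ici.1 ha), max_eq_right (mem_Ici.1 hb)] using this
  let _ := coordSigma (Ici s)
  refine ⟨μ.map (toPathSpace G hGsub), Measure.isProbabilityMeasure_map mΦ.aemeasurable, ?_, ?_⟩
  · rw [ae_map_iff mΦ.aemeasurable (measurableSet_initial rfl x)]
    filter_upwards [hs, hae] with y h1 h2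
    rw [h2, h1]
  · exact hM'.map mΦ (fun t ht => measurable_coordProcess ht) hae

end IsBranchingKernelFamily

/-- Uniqueness of the law on path space. -/
theorem pathLaw_unique {k : ℝ≥0 → ℝ≥0 → Kernel ℝ≥0∞ ℝ≥0∞} {s : ℝ≥0} {x : ℝ≥0∞} {mΩ : MeasurableSpace BranchingPathSpace}
    (hm : mΩ = coordSigma (Ici s)) {P P' : Measure BranchingPathSpace}
    [IsProbabilityMeasure P] [IsProbabilityMeasure P']
    (h0 : ∀ᵐ ω ∂P, coordProcess s ω = x) (h0' : ∀ᵐ ω ∂P', coordProcess s ω = x)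
    (hP : IsMarkovOn k (Ici s) coordProcess P) (hP' : IsMarkovOn k (Ici s) coordProcess P') :
    P = P' :=
  ext_of_lintegral_prod_eq hm fun K hK g hg =>
    hP.lintegral_prod_eq hP' self_mem_Ici h0 h0' K (fun t ht => ⟨hK t ht, hK t ht⟩) g hg

lemma coordSigma_Icc (s t : ℝ≥0) : coordSigma (Icc s t) =
    ⨆ r ∈ Ici s ∩ Iic t, MeasurableSpace.comap (coordProcess r) inferInstance := by
  rw [coordSigma, Ici_inter_Iic]

theorem mainTheorem8 (k : ℝ≥0 → ℝ≥0 → Kernel ℝ≥0∞ ℝ≥0∞) (hk : IsBranchingKernelFamily k) :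
    ∃! Q : (s : ℝ≥0) → ℝ≥0∞ → @Measure BranchingPathSpace (coordSigma (Ici s)),
      IsBranchingProcess k coordProcess (coordSigma (Ici 0)) coordSigma Q := by
  choose Q hQp hQ0 hQM using hk.exists_pathLaw
  refine ⟨Q, ⟨hk, ?_⟩, ?_⟩
  · refine ⟨hk.toIsTransitionFamily, fun I _ => coordSigma_mono fun _ _ => mem_Ici.2 zero_le,
      fun I J _ _ h => coordSigma_mono h, fun I _ t ht => measurable_coordProcess ht, hQp, ?_, ?_⟩
    · intro s x
      have := hQp s x
      exact (mem_ae_iff_prob_eq_one (measurableSet_initial rfl x)).1 (hQ0 s x)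
    · intro s t u hst htu x f hf ⟨C, hC⟩
      have := hQp s x
      exact (hQM s x).condExp_ae_eq hk.isTransitionOn
        (fun r hr => measurable_coordProcess hr) hst (hst.trans htu) htu
        (coordSigma_Icc s t) hf hC
  · intro Q' hQ'
    have hF := hQ'.markov_family
    funext s x
    have := hQp s x
    have := hF.prob s x
    have h0' : ∀ᵐ ω ∂(Q' s x), coordProcess s ω = x :=
      (mem_ae_iff_prob_eq_one (measurableSet_initial rfl x)).2 (hF.initial s x)
    refine pathLaw_unique rfl h0' (hQ0 s x) ?_ (hQM s x)
    refine isMarkovOn_of_condExp hk.isTransitionOn (fun r hr => measurable_coordProcess hr) ?_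
    intro a ha b hb hab f hf hC
    rw [← coordSigma_Icc]
    exact hF.markov_property s a b ha hab x f hf hC
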